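/- Let $\mathbf{Dia}$ be a diagram category, i.e. a full sub-2-category of the 2-category of small categories that contains $\{0<1\}$, is closed under finite products, finite coproducts, opposites, subcategories and slices $I/i$, and contains the source of every Grothendieck fibration whose base and fibers it contains. Let $\mathbb{D}$ be a closed monoidal derivator of type $\mathbf{Dia}$: a pseudofunctor, contravariant on 1-cells and 2-cells, $u\mapsto u^*$, from $\mathbf{Dia}$ to closed symmetric monoidal categories, strong symmetric monoidal functors and monoidal transformations, such that (D1) $\mathbb{D}$ takes coproducts to products; (D2) for every $I$ the fiber functors $i^*:\mathbb{D}(I)\to\mathbb{D}(\star)$, $i\in I$, are jointly conservative ($\star$ is the terminal category); (D3) every $u^*$ has a left adjoint $u_\#$ and a right adjoint $u_*$; (D4) for $u:I\to J$ and $j\in J$, the Beck–Chevalley morphisms $p_{j\backslash I\#}t^*\to j^*u_\#$ and $j^*u_*\to p_{I/j*}s^*$ of the two comma squares are invertible, where $t:j\backslash I\to I$ and $s:I/j\to I$ are the projections and $p_K:K\to\star$; and (M) the projection morphism $p_{I\#}(p_I^*A\otimes B)\to A\otimes p_{I\#}B$ is invertible for all $I$, $A\in\mathbb{D}(\star)$,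 $B\in\mathbb{D}(I)$. The twisted arrow category $\mathrm{tw}(I)$ has as objects the arrows of $I$; a morphism from $i\to j$ to $i'\to j'$ is a pair $(i'\to i,\ j\to j')$ such that the composite $i'\to i\to j\to j'$ is the given arrow $i'\to j'$. For $I,J\in\mathbf{Dia}$ let $p:\mathrm{tw}(I)\times J\to I^\circ\times J$, $q:\mathrm{tw}(I)\times J\to I$ and $r:\mathrm{tw}(I)\times J\to J$ send $(i\to i',j)$ to $(i,j)$, $i'$ and $j$ respectively. For $A\in\mathbb{D}(I)$, $B\in\mathbb{D}(J)$ put $$[\![A,B]\!]:=p_*[q^*A,r^*B]\in\mathbb{D}(I^\circ\times J),$$ where $[\cdot,\cdot]$ is the internal hom and $[\![\cdot,\cdot]\!]$ is called the external hom. For $u:I'\to I$, $v:J'\to J$ in $\mathbf{Dia}$ let $p',q',r'$ be the corresponding functors for $I',J'$, and let $\Psi^{u,v}_{A,B}$ be the composite of canonical morphisms $$(u^\circ\times v)^*p_*[q^*A,r^*B]\to p'_*(\mathrm{tw}(u)\times v)^*[q^*A,r^*B]\to p'_*[(\mathrm{tw}(u)\times v)^*q^*A,(\mathrm{tw}(u)\times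 v)^*r^*B]\cong p'_*[q'^*u^*A,r'^*v^*B],$$ the first being the base change morphism and the second induced by the monoidal structure of $(\mathrm{tw}(u)\times v)^*$. Proposition. For all $I,I',J,J'\in\mathbf{Dia}$, functors $u:I'\to I$, $v:J'\to J$ and objects $A\in\mathbb{D}(I)$, $B\in\mathbb{D}(J)$, the morphism $$\Psi^{u,v}_{A,B}:(u^\circ\times v)^*[\![A,B]\!]\to[\![u^*A,v^*B]\!]$$ is invertible. In particular, for all $i\in I$ and $j\in J$, with $x=(1_i,j):\star\to\mathrm{tw}(I)\times J$, the canonical morphism $$[\![A,B]\!]_{(i,j)}=(i,j)^*p_*[q^*A,r^*B]\cong x^*p^*p_*[q^*A,r^*B]\to x^*[q^*A,r^*B]\to[x^*q^*A,x^*r^*B]\cong[A_i,B_j]$$ is an isomorphism, where $A_i=i^*A$, $B_j=j^*B$. -/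

import Mathlib

open CategoryTheory MonoidalCategory Opposite

universe w v u

namespace ExternalHom

/-! ### Twisted arrow categories -/

/-- Objects of the twisted arrow category of `I`: arrows `src ⟶ tgt` of `I`. -/
structure TwistedArrow (I : Type w) [Category.{w} I] : Type w where
  src : I
  tgt : I
  hom : src ⟶ tgt

namespace TwistedArrow

variable {I : Type w} [Category.{w} I]

/-- A morphism from `f : i ⟶ j` to `g : i' ⟶ j'` is a pair `i' ⟶ i`, `j ⟶ j'` such that
`i' ⟶ i ⟶ j ⟶ j'` is `g`. -/
@[ext]
structure Hom (f g : TwistedArrow I) : Type w where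
  left : g.src ⟶ f.src
  right : f.tgt ⟶ g.tgt
  w : left ≫ f.hom ≫ right = g.hom

instance : Category.{w} (TwistedArrow I) where
  Hom := Hom
  id f := ⟨𝟙 _, 𝟙 _, by simp⟩
  comp {f g h} a b := ⟨b.left ≫ a.left, a.right ≫ b.right, by
    rw [← b.w, ← a.w]; simp only [Category.assoc]⟩
  id_comp _ := Hom.ext (Category.comp_id _) (Category.id_comp _)
  comp_id _ := Hom.ext (Category.id_comp _) (Category.comp_id _)
  assoc _ _ _ := Hom.ext (Category.assoc _ _ _).symm (Category.assoc _ _ _)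

/-- The canonical functor `tw(I) ⥤ Iᵒᵖ × I`. -/
def proj (I : Type w) [Category.{w} I] : TwistedArrow I ⥤ Iᵒᵖ × I where
  obj f := (op f.src, f.tgt)
  map a := (a.left.op, a.right)
  map_id _ := rfl
  map_comp _ _ := rfl

/-- The functor `tw(u) : tw(I') ⥤ tw(I)` induced by `u : I' ⥤ I`. -/
def map {I' : Type w} [Category.{w} I'] (u : I' ⥤ I) : TwistedArrow I' ⥤ TwistedArrow I where
  obj f := ⟨u.obj f.src, u.obj f.tgt, u.map f.hom⟩
  map {f g} a := ⟨u.map a.left, u.map a.right, by rw [← a.w, u.map_comp, u.map_comp]⟩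
  map_id _ := Hom.ext (u.map_id _) (u.map_id _)
  map_comp _ _ := Hom.ext (u.map_comp _ _) (u.map_comp _ _)

end TwistedArrow

/-! ### Diagram categories -/

/-- A diagram category: a full sub-2-category of the 2-category of small categories, given by the
class `mem` of its objects. "Closed under subcategories" is stated for monomorphisms of
categories, that is, functors that are faithful and injective on objects. -/
structure DiagramCategory where
  mem : ∀ (I : Type w) [Category.{w} I], Prop
  /-- it contains the ordered set `{0 < 1}` -/
  two_mem : mem (ULift.{w} (Fin 2))
  terminal_mem : mem (Discrete PUnit.{w + 1})
  prod_mem : ∀ {I J : Type w} [Category.{w} I] [Category.{w} J], mem I → mem J → mem (I × J)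
  initial_mem : mem (Discrete PEmpty.{w + 1})
  sum_mem : ∀ {I J : Type w} [Category.{w} I] [Category.{w} J], mem I → mem J → mem (I ⊕ J)
  op_mem : ∀ {I : Type w} [Category.{w} I], mem I → mem Iᵒᵖ
  sub_mem : ∀ {I J : Type w} [Category.{w} I] [Category.{w} J] (F : I ⥤ J),
    F.Faithful → Function.Injective F.obj → mem J → mem I
  over_mem : ∀ {I : Type w} [Category.{w} I], mem I → ∀ i : I, mem (Over i)
  fibration_mem : ∀ {I J : Type w} [Category.{w} I] [Category.{w} J] (p : I ⥤ J),
    p.IsFibered → (∀ j : J, mem (p.Fiber j)) → mem J → mem I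

namespace DiagramCategory

/-- The objects of a diagram category. The 1-cells and 2-cells are all functors and all natural
transformations. -/
structure Obj (Dia : DiagramCategory.{w}) where
  carrier : Type w
  [cat : Category.{w} carrier]
  mem : Dia.mem carrier

attribute [instance] Obj.cat

instance (Dia : DiagramCategory.{w}) : CoeSort Dia.Obj (Type w) := ⟨Obj.carrier⟩

variable {Dia : DiagramCategory.{w}}

theorem over_mk_injective {I : Type w} [Category.{w} I] {i j : I} {f g : i ⟶ j}
    (h : Over.mk f = Over.mk g) : f = g := by
  have h' : (Comma.mk i ⟨⟨⟩⟩ f : Comma (𝟭 I) (Functor.fromPUnit j)) = Comma.mk i ⟨⟨⟩⟩ g := h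
  injection h' with _ _ h3

theorem costructuredArrow_mem {I J : Type w} [Category.{w} I] [Category.{w} J]
    (hI : Dia.mem I) (hJ : Dia.mem J) (F : I ⥤ J) (j : J) :
    Dia.mem (CostructuredArrow F j) := by
  let G : CostructuredArrow F j ⥤ I × Over j :=
    (CostructuredArrow.proj F j).prod' (CostructuredArrow.toOver F j)
  refine Dia.sub_mem G ⟨fun {X Y} f g h => ?_⟩ ?_ (Dia.prod_mem hI (Dia.over_mem hJ j))
  · ext
    exact congrArg Prod.fst h
  · rintro ⟨x, ⟨⟨⟩⟩, f⟩ ⟨y, ⟨⟨⟩⟩, g⟩ h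
    obtain ⟨h1, h2⟩ := Prod.mk.inj h
    change x = y at h1
    subst h1
    obtain rfl : f = g := over_mk_injective h2
    rfl

theorem structuredArrow_mem {I J : Type w} [Category.{w} I] [Category.{w} J]
    (hI : Dia.mem I) (hJ : Dia.mem J) (F : I ⥤ J) (j : J) :
    Dia.mem (StructuredArrow j F) := by
  have hw : ∀ {X Y : StructuredArrow j F} (f : X ⟶ Y),
      (F.map f.right).op ≫ X.hom.op = Y.hom.op := fun f => by
    rw [← op_comp, StructuredArrow.w]
  let G : StructuredArrow j F ⥤ I × (Over (op j))ᵒᵖ :=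
    { obj := fun X => (X.right, op (Over.mk X.hom.op))
      map := fun {X Y} f => (f.right,
        Quiver.Hom.op (V := Over (op j)) (Over.homMk (F.map f.right).op (hw f)))
      map_id := fun X => Prod.ext rfl (Quiver.Hom.unop_inj (by ext; simp))
      map_comp := fun _ _ => Prod.ext rfl (Quiver.Hom.unop_inj (by ext; simp)) }
  refine Dia.sub_mem G ⟨fun {X Y} f g h => ?_⟩ ?_
    (Dia.prod_mem hI (Dia.op_mem (Dia.over_mem (Dia.op_mem hJ) (op j))))
  · ext
    exact congrArg Prod.fst h
  · rintro ⟨⟨⟨⟩⟩, x, f⟩ ⟨⟨⟨⟩⟩, y, g⟩ h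
    obtain ⟨h1, h2⟩ := Prod.mk.inj h
    change x = y at h1
    subst h1
    obtain rfl : f = g := Quiver.Hom.op_inj (over_mk_injective (congrArg unop h2))
    rfl

theorem twistedArrow_mem {I : Type w} [Category.{w} I] (hI : Dia.mem I) :
    Dia.mem (TwistedArrow I) := by
  have hdisc : ∀ i j : I, Dia.mem (Discrete (i ⟶ j)) := fun i j =>
    Dia.sub_mem (Discrete.functor (fun f : i ⟶ j => Over.mk f))
      ⟨fun _ => Subsingleton.elim _ _⟩
      (by
        rintro ⟨f⟩ ⟨g⟩ h
        exact congrArg Discrete.mk (over_mk_injective h))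
      (Dia.over_mem hI j)
  have hop : Dia.mem (TwistedArrow I)ᵒᵖ := by
    refine Dia.fibration_mem (TwistedArrow.proj I).op ?_ ?_
      (Dia.op_mem (Dia.prod_mem (Dia.op_mem hI) hI))
    · apply Functor.IsFibered.of_exists_isStronglyCartesian
      rintro ⟨a⟩ ⟨⟨⟨s⟩, t⟩⟩ f
      let b : TwistedArrow I := ⟨s, t, f.unop.1.unop ≫ a.hom ≫ f.unop.2⟩
      let φ : op b ⟶ op a := Quiver.Hom.op (V := TwistedArrow I) ⟨f.unop.1.unop, f.unop.2, rfl⟩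
      have hφ : (TwistedArrow.proj I).op.map φ = f := rfl
      refine ⟨op b, φ, ?_⟩
      refine { toIsHomLift := Functor.IsHomLift.map φ, universal_property' := ?_ }
      rintro ⟨c⟩ g ψ hψ
      have e : g ≫ f = (TwistedArrow.proj I).op.map ψ :=
        IsHomLift.eq_of_isHomLift ((TwistedArrow.proj I).op)
          (a := op c) (b := op a) (g ≫ f) ψ
      have e1 : ψ.unop.left = g.unop.1.unop ≫ f.unop.1.unop :=
        (congrArg (fun k => k.unop.1.unop) e).symm
      have e2 : ψ.unop.right = f.unop.2 ≫ g.unop.2 :=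
        (congrArg (fun k => k.unop.2) e).symm
      have hw : g.unop.1.unop ≫ b.hom ≫ g.unop.2 = c.hom := by
        rw [← ψ.unop.w, e1, e2]
        have aux : ∀ {x₁ x₂ x₃ x₄ x₅ x₆ : I} (p₁ : x₁ ⟶ x₂) (p₂ : x₂ ⟶ x₃) (p₃ : x₃ ⟶ x₄)
            (p₄ : x₄ ⟶ x₅) (p₅ : x₅ ⟶ x₆),
            p₁ ≫ (p₂ ≫ p₃ ≫ p₄) ≫ p₅ = (p₁ ≫ p₂) ≫ p₃ ≫ p₄ ≫ p₅ := by
          intros; simp only [Category.assoc]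
        exact aux _ _ _ _ _
      let χ : op c ⟶ op b :=
        Quiver.Hom.op (V := TwistedArrow I) ⟨g.unop.1.unop, g.unop.2, hw⟩
      refine ⟨χ, ⟨Functor.IsHomLift.map χ, ?_⟩, ?_⟩
      · apply Quiver.Hom.unop_inj
        exact TwistedArrow.Hom.ext e1.symm e2.symm
      · rintro χ' ⟨h1, -⟩
        have e' : g = (TwistedArrow.proj I).op.map χ' :=
          @IsHomLift.eq_of_isHomLift _ _ _ _ (TwistedArrow.proj I).op (op c) (op b) g χ' h1
        apply Quiver.Hom.unop_inj
        exact TwistedArrow.Hom.ext (congrArg (fun k => k.unop.1.unop) e').symm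
          (congrArg (fun k => k.unop.2) e').symm
    · rintro ⟨⟨⟨i⟩, j⟩⟩
      have key : ∀ a b : (TwistedArrow.proj I).op.Fiber (op (op i, j)), (a ⟶ b) → a = b := by
        rintro ⟨⟨s, t, f⟩, ha⟩ ⟨⟨s', t', f'⟩, hb⟩ ⟨m, hm⟩
        have ha' : (op s, t) = (op i, j) := congrArg unop ha
        have hb' : (op s', t') = (op i, j) := congrArg unop hb
        obtain ⟨h1, h2⟩ := Prod.mk.inj ha'
        obtain ⟨h3, h4⟩ := Prod.mk.inj hb'
        cases h1; cases h2; cases h3; cases h4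
        have e : 𝟙 (op (op i, j)) = (TwistedArrow.proj I).op.map m :=
          @IsHomLift.eq_of_isHomLift _ _ _ _ (TwistedArrow.proj I).op (op ⟨i, j, f⟩)
            (op ⟨i, j, f'⟩) (𝟙 (op (op i, j))) m hm
        have e1 : m.unop.left = 𝟙 _ := (congrArg (fun k => k.unop.1.unop) e).symm
        have e2 : m.unop.right = 𝟙 _ := (congrArg (fun k => k.unop.2) e).symm
        have e3 : f' = f := by
          have h := m.unop.w
          rw [e1, e2] at h
          exact (Category.id_comp _).symm.trans ((congrArg _ (Category.comp_id _)).symm.trans h)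
        cases e3
        rfl
      have hj : ∀ a : (TwistedArrow.proj I).op.Fiber (op (op i, j)),
          ∃ f : i ⟶ j, a.1 = op (⟨i, j, f⟩ : TwistedArrow I) := by
        rintro ⟨⟨s, t, f⟩, ha⟩
        obtain ⟨h1, h2⟩ := Prod.mk.inj (congrArg unop ha : (op s, t) = (op i, j))
        cases h1; cases h2
        exact ⟨f, rfl⟩
      choose k hk using hj
      refine Dia.sub_mem (J := Discrete (i ⟶ j))
        { obj := fun a => ⟨k a⟩
          map := fun {a b} m => eqToHom (by rw [key a b m])
          map_id := fun _ => rfl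
          map_comp := fun _ _ => Subsingleton.elim _ _ } ⟨fun {a b} m n _ => ?_⟩ ?_ (hdisc i j)
      · have hm := @IsHomLift.fac' _ _ _ _ (TwistedArrow.proj I).op _ _ _ _ (𝟙 _) m.1 m.2
        have hn := @IsHomLift.fac' _ _ _ _ (TwistedArrow.proj I).op _ _ _ _ (𝟙 _) n.1 n.2
        have h := hm.trans hn.symm
        apply Subtype.ext
        apply Quiver.Hom.unop_inj
        exact TwistedArrow.Hom.ext (congrArg (fun k => k.unop.1.unop) h)
          (congrArg (fun k => k.unop.2) h)
      · intro a b h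
        have h' : k a = k b := congrArg Discrete.as h
        exact Subtype.ext ((hk a).trans ((congrArg (fun f => op (⟨i, j, f⟩ : TwistedArrow I)) h').trans
          (hk b).symm))
  exact Dia.sub_mem (opOp (TwistedArrow I)) inferInstance
    (fun _ _ h => congrArg (fun k => k.unop.unop) h) (Dia.op_mem hop)

/-- The terminal category. -/
abbrev pt (Dia : DiagramCategory.{w}) : Dia.Obj := ⟨Discrete PUnit.{w + 1}, Dia.terminal_mem⟩

/-- The opposite category. -/
abbrev Obj.opp (I : Dia.Obj) : Dia.Obj := ⟨I.carrierᵒᵖ, Dia.op_mem I.mem⟩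

/-- The product of two categories. -/
abbrev Obj.prod (I J : Dia.Obj) : Dia.Obj := ⟨I.carrier × J.carrier, Dia.prod_mem I.mem J.mem⟩

/-- The twisted arrow category. -/
abbrev Obj.tw (I : Dia.Obj) : Dia.Obj := ⟨TwistedArrow I.carrier, twistedArrow_mem I.mem⟩

/-- The category of objects `F`-under `j`. -/
abbrev Obj.under {I J : Dia.Obj} (F : I ⥤ J) (j : J) : Dia.Obj :=
  ⟨StructuredArrow j F, structuredArrow_mem I.mem J.mem F j⟩

/-- The category of objects `F`-over `j`. -/
abbrev Obj.over {I J : Dia.Obj} (F : I ⥤ J) (j : J) : Dia.Obj :=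
  ⟨CostructuredArrow F j, costructuredArrow_mem I.mem J.mem F j⟩

/-- The projection from the category of objects `F`-under `j`. -/
abbrev Obj.underProj {I J : Dia.Obj} (F : I ⥤ J) (j : J) : Obj.under F j ⥤ I :=
  StructuredArrow.proj j F

/-- The projection from the category of objects `F`-over `j`. -/
abbrev Obj.overProj {I J : Dia.Obj} (F : I ⥤ J) (j : J) : Obj.over F j ⥤ I :=
  CostructuredArrow.proj F j

/-- The functor from the terminal category pointing at `i`. -/
abbrev Obj.at {I : Dia.Obj} (i : I) : Dia.pt ⥤ I := Functor.fromPUnit i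

/-- The functor to the terminal category. -/
abbrev Obj.toPt (I : Dia.Obj) : I ⥤ Dia.pt := Functor.star I

end DiagramCategory

open DiagramCategory

/-! ### Prederivators and derivators -/

/-- A prederivator of type `Dia`: a pseudofunctor from the 2-category obtained from `Dia` by
reversing 1-cells and 2-cells to the 2-category of (possibly large) categories. The value at
`u : I ⥤ J` is `pull u`, written `u^*`, and the value at `η : u ⟶ u'` is
`pull₂ η : u'^* ⟶ u^*`. -/
structure Prederivator (Dia : DiagramCategory.{w}) where
  obj : Dia.Obj → Type u
  [cat : ∀ I, Category.{v} (obj I)]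
  pull : ∀ {I J : Dia.Obj}, (I ⥤ J) → (obj J ⥤ obj I)
  pull₂ : ∀ {I J : Dia.Obj} {u u' : I ⥤ J}, (u ⟶ u') → (pull u' ⟶ pull u)
  pullId : ∀ I : Dia.Obj, pull (𝟭 I) ≅ 𝟭 (obj I)
  pullComp : ∀ {I J K : Dia.Obj} (u : I ⥤ J) (t : J ⥤ K), pull (u ⋙ t) ≅ pull t ⋙ pull u
  pull₂_id : ∀ {I J : Dia.Obj} (u : I ⥤ J), pull₂ (𝟙 u) = 𝟙 (pull u)
  pull₂_comp : ∀ {I J : Dia.Obj} {u u' u'' : I ⥤ J} (η : u ⟶ u') (θ : u' ⟶ u''),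
    pull₂ (η ≫ θ) = pull₂ θ ≫ pull₂ η
  pull₂_whiskerRight : ∀ {I J K : Dia.Obj} {u u' : I ⥤ J} (η : u ⟶ u') (t : J ⥤ K),
    pull₂ (Functor.whiskerRight η t) ≫ (pullComp u t).hom =
      (pullComp u' t).hom ≫ Functor.whiskerLeft (pull t) (pull₂ η)
  pull₂_whiskerLeft : ∀ {I J K : Dia.Obj} (u : I ⥤ J) {t t' : J ⥤ K} (θ : t ⟶ t'),
    pull₂ (Functor.whiskerLeft u θ) ≫ (pullComp u t).hom =
      (pullComp u t').hom ≫ Functor.whiskerRight (pull₂ θ) (pull u)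
  pull_assoc : ∀ {I J K L : Dia.Obj} (u : I ⥤ J) (t : J ⥤ K) (s : K ⥤ L) (A : obj L),
    (pullComp (u ⋙ t) s).hom.app A ≫ (pullComp u t).hom.app ((pull s).obj A) =
      (pull₂ (Functor.associator u t s).inv).app A ≫ (pullComp u (t ⋙ s)).hom.app A ≫
        (pull u).map ((pullComp t s).hom.app A)
  pull_id_comp : ∀ {I J : Dia.Obj} (u : I ⥤ J) (A : obj J),
    (pullComp (𝟭 I) u).hom.app A ≫ (pullId I).hom.app ((pull u).obj A) =
      (pull₂ u.leftUnitor.inv).app A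
  pull_comp_id : ∀ {I J : Dia.Obj} (u : I ⥤ J) (A : obj J),
    (pullComp u (𝟭 J)).hom.app A ≫ (pull u).map ((pullId J).hom.app A) =
      (pull₂ u.rightUnitor.inv).app A

attribute [instance] Prederivator.cat

namespace Prederivator

variable {Dia : DiagramCategory.{w}} (D : Prederivator.{w, v, u} Dia)

/-- The fiber functor `i^* : D(I) ⥤ D(⋆)`. -/
abbrev fiber {I : Dia.Obj} (i : I) : D.obj I ⥤ D.obj Dia.pt := D.pull (Obj.at i)

/-- For a square
```
  K' --g--> K
  |         |
  k'        k
  v         v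
  L' --f--> L
```
with a 2-cell `α : k' ≫ f ⟶ g ≫ k`, the induced transformation `g^* k^* ⟶ k'^* f^*`. -/
def square {K K' L L' : Dia.Obj} {g : K' ⥤ K} {k' : K' ⥤ L'} {k : K ⥤ L} {f : L' ⥤ L}
    (α : k' ⋙ f ⟶ g ⋙ k) : D.pull k ⋙ D.pull g ⟶ D.pull f ⋙ D.pull k' :=
  (D.pullComp g k).inv ≫ D.pull₂ α ≫ (D.pullComp k' f).hom

/-- Existence of the left adjoint `u_#` and of the right adjoint `u_*` of every `u^*`. -/
class HasKanExtensions : Prop where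
  isRightAdjoint : ∀ {I J : Dia.Obj} (u : I ⥤ J), (D.pull u).IsRightAdjoint
  isLeftAdjoint : ∀ {I J : Dia.Obj} (u : I ⥤ J), (D.pull u).IsLeftAdjoint

attribute [instance] HasKanExtensions.isRightAdjoint HasKanExtensions.isLeftAdjoint

section

variable [D.HasKanExtensions]

/-- The left adjoint `u_#` of `u^*`. -/
noncomputable def pushL {I J : Dia.Obj} (u : I ⥤ J) : D.obj I ⥤ D.obj J := (D.pull u).leftAdjoint

/-- The right adjoint `u_*` of `u^*`. -/
noncomputable def pushR {I J : Dia.Obj} (u : I ⥤ J) : D.obj I ⥤ D.obj J := (D.pull u).rightAdjoint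

/-- The adjunction `u_# ⊣ u^*`. -/
noncomputable def adjL {I J : Dia.Obj} (u : I ⥤ J) : D.pushL u ⊣ D.pull u :=
  Adjunction.ofIsRightAdjoint (D.pull u)

/-- The adjunction `u^* ⊣ u_*`. -/
noncomputable def adjR {I J : Dia.Obj} (u : I ⥤ J) : D.pull u ⊣ D.pushR u :=
  Adjunction.ofIsLeftAdjoint (D.pull u)

variable {K K' L L' : Dia.Obj} {g : K' ⥤ K} {k' : K' ⥤ L'} {k : K ⥤ L} {f : L' ⥤ L}

/-- The Beck-Chevalley transformation `k'_# g^* ⟶ f^* k_#` of a 2-cell `k' ≫ f ⟶ g ≫ k`: the mate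
of `g^* k^* ⟶ k'^* f^*`. -/
noncomputable def baseChangeL (α : k' ⋙ f ⟶ g ⋙ k) :
    D.pull g ⋙ D.pushL k' ⟶ D.pushL k ⋙ D.pull f :=
  ((mateEquiv (D.adjL k) (D.adjL k')).symm (TwoSquare.mk _ _ _ _ (D.square α))).natTrans

/-- The Beck-Chevalley transformation `f^* k_* ⟶ k'_* g^*` of a 2-cell `g ≫ k ⟶ k' ≫ f`: the mate
of `k'^* f^* ⟶ g^* k^*`. -/
noncomputable def baseChangeR (α : g ⋙ k ⟶ k' ⋙ f) :
    D.pushR k ⋙ D.pull f ⟶ D.pull g ⋙ D.pushR k' :=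
  (mateEquiv (D.adjR k) (D.adjR k') (TwoSquare.mk _ _ _ _ (D.square α))).natTrans

end

/-- The 2-cell of the comma square of `j\I`, for `u : I ⥤ J` and `j` in `J`. -/
def underCell {I J : Dia.Obj} (u : I ⥤ J) (j : J) :
    (Obj.under u j).toPt ⋙ Obj.at j ⟶ Obj.underProj u j ⋙ u where
  app f := f.hom
  naturality _ _ a := (Category.id_comp _).trans (StructuredArrow.w a).symm

/-- The 2-cell of the comma square of `I/j`, for `u : I ⥤ J` and `j` in `J`. -/
def overCell {I J : Dia.Obj} (u : I ⥤ J) (j : J) :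
    Obj.overProj u j ⋙ u ⟶ (Obj.over u j).toPt ⋙ Obj.at j where
  app f := f.hom
  naturality _ _ a := (CostructuredArrow.w a).trans (Category.comp_id _).symm

/-- The axioms of a derivator. -/
class IsDerivator : Prop extends D.HasKanExtensions where
  /-- `D` takes coproducts (those that exist in `Dia`) to products. -/
  coproduct : ∀ {ι : Type w} (I : ι → Dia.Obj) (h : Dia.mem (Σ k, (I k).carrier)),
    (Functor.pi' fun k => D.pull (J := ⟨Σ k, (I k).carrier, h⟩)
      (Sigma.incl (C := fun k => (I k).carrier) k)).IsEquivalence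
  conservative : ∀ {I : Dia.Obj} {A B : D.obj I} (f : A ⟶ B),
    (∀ i : I, IsIso ((D.fiber i).map f)) → IsIso f
  under_isIso : ∀ {I J : Dia.Obj} (u : I ⥤ J) (j : J), IsIso (D.baseChangeL (underCell u j))
  over_isIso : ∀ {I J : Dia.Obj} (u : I ⥤ J) (j : J), IsIso (D.baseChangeR (overCell u j))

end Prederivator

/-! ### Closed monoidal derivators -/

/-- A closed monoidal prederivator: a prederivator that factors through the 2-category of closed
symmetric monoidal categories, strong symmetric monoidal functors and monoidal transformations. -/
structure ClosedMonoidalPrederivator (Dia : DiagramCategory.{w}) extends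
    Prederivator.{w, v, u} Dia where
  [monoidal : ∀ I, MonoidalCategory (obj I)]
  [symmetric : ∀ I, SymmetricCategory (obj I)]
  [closed : ∀ I, MonoidalClosed (obj I)]
  [braided : ∀ {I J : Dia.Obj} (u : I ⥤ J), (pull u).Braided]
  pull₂_isMonoidal : ∀ {I J : Dia.Obj} {u u' : I ⥤ J} (η : u ⟶ u'), NatTrans.IsMonoidal (pull₂ η)
  pullId_isMonoidal : ∀ I : Dia.Obj, NatTrans.IsMonoidal (pullId I).hom
  pullComp_isMonoidal : ∀ {I J K : Dia.Obj} (u : I ⥤ J) (t : J ⥤ K),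
    NatTrans.IsMonoidal (pullComp u t).hom

attribute [instance] ClosedMonoidalPrederivator.monoidal ClosedMonoidalPrederivator.symmetric
  ClosedMonoidalPrederivator.closed ClosedMonoidalPrederivator.braided

/-- The canonical morphism `F[A, B] ⟶ [FA, FB]` for a monoidal functor `F` between closed monoidal
categories: the adjoint of `FA ⊗ F[A, B] ≅ F(A ⊗ [A, B]) ⟶ FB`. -/
noncomputable def ihomComparison {C : Type u} [Category.{v} C] [MonoidalCategory C]
    [MonoidalClosed C] {E : Type u} [Category.{v} E] [MonoidalCategory E] [MonoidalClosed E]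
    (F : C ⥤ E) [F.Monoidal] (A B : C) :
    F.obj ((ihom A).obj B) ⟶ (ihom (F.obj A)).obj (F.obj B) :=
  MonoidalClosed.curry (Functor.LaxMonoidal.μ F A ((ihom A).obj B) ≫ F.map ((ihom.ev A).app B))

/-- The morphism `[A, B] ⟶ [A', B']` induced by `a : A' ⟶ A` and `b : B ⟶ B'`. -/
noncomputable def ihomMap {C : Type u} [Category.{v} C] [MonoidalCategory C] [MonoidalClosed C]
    {A A' B B' : C} (a : A' ⟶ A) (b : B ⟶ B') :
    (ihom A).obj B ⟶ (ihom A').obj B' :=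
  (ihom A).map b ≫ (MonoidalClosed.pre a).app B'

namespace ClosedMonoidalPrederivator

variable {Dia : DiagramCategory.{w}} (D : ClosedMonoidalPrederivator.{w, v, u} Dia)

/-- The projection morphism `p_#(p^* A ⊗ B) ⟶ A ⊗ p_# B` for the functor `p : I ⥤ ⋆`: the adjoint of
`p^* A ⊗ B ⟶ p^* A ⊗ p^* p_# B ≅ p^*(A ⊗ p_# B)`. -/
noncomputable def projectionMorphism [D.HasKanExtensions] (I : Dia.Obj) (A : D.obj Dia.pt)
    (B : D.obj I) :
    (D.pushL I.toPt).obj ((D.pull I.toPt).obj A ⊗ B) ⟶ A ⊗ (D.pushL I.toPt).obj B :=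
  ((D.adjL I.toPt).homEquiv _ _).symm
    ((D.pull I.toPt).obj A ◁ (D.adjL I.toPt).unit.app B ≫
      Functor.LaxMonoidal.μ (D.pull I.toPt) A ((D.pushL I.toPt).obj B))

end ClosedMonoidalPrederivator

/-- A closed monoidal derivator. -/
structure ClosedMonoidalDerivator (Dia : DiagramCategory.{w}) extends
    ClosedMonoidalPrederivator.{w, v, u} Dia where
  [isDerivator : toPrederivator.IsDerivator]
  projection_isIso : ∀ (I : Dia.Obj) (A : obj Dia.pt) (B : obj I),
    IsIso (toClosedMonoidalPrederivator.projectionMorphism I A B)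

attribute [instance] ClosedMonoidalDerivator.isDerivator

/-! ### The external hom -/

section Pi

variable {Dia : DiagramCategory.{w}} (I J : Dia.Obj)

/-- `p : tw(I) × J ⥤ Iᵒᵖ × J`. -/
def piP : I.tw.prod J ⥤ I.opp.prod J where
  obj x := (op x.1.src, x.2)
  map a := (a.1.left.op, a.2)
  map_id _ := rfl
  map_comp _ _ := rfl

/-- `q : tw(I) × J ⥤ I`, the target functor. -/
def piQ : I.tw.prod J ⥤ I where
  obj x := x.1.tgt
  map a := a.1.right
  map_id _ := rfl
  map_comp _ _ := rfl

/-- `r : tw(I) × J ⥤ J`. -/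
def piR : I.tw.prod J ⥤ J where
  obj x := x.2
  map a := a.2
  map_id _ := rfl
  map_comp _ _ := rfl

end Pi

namespace ClosedMonoidalDerivator

variable {Dia : DiagramCategory.{w}} (D : ClosedMonoidalDerivator.{w, v, u} Dia)

/-- The external hom `⟦A, B⟧ = p_*[q^* A, r^* B]` in `D(Iᵒᵖ × J)`. -/
noncomputable def ehom {I J : Dia.Obj} (A : D.obj I) (B : D.obj J) : D.obj (I.opp.prod J) :=
  (D.pushR (piP I J)).obj
    ((ihom ((D.pull (piQ I J)).obj A)).obj ((D.pull (piR I J)).obj B))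

section Psi

variable {I I' J J' : Dia.Obj} (s : I' ⥤ I) (t : J' ⥤ J)

/-- `sᵒᵖ × t : I'ᵒᵖ × J' ⥤ Iᵒᵖ × J`. -/
abbrev opProd : I'.opp.prod J' ⥤ I.opp.prod J := s.op.prod t

/-- `tw(s) × t : tw(I') × J' ⥤ tw(I) × J`. -/
abbrev twProd : I'.tw.prod J' ⥤ I.tw.prod J := (TwistedArrow.map s).prod t

/-- The equality `p ∘ (tw(s) × t) = (sᵒᵖ × t) ∘ p'`, as a 2-cell. -/
def cellP : twProd s t ⋙ piP I J ⟶ piP I' J' ⋙ opProd s t where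
  app _ := 𝟙 _
  naturality _ _ _ := (Category.comp_id _).trans (Category.id_comp _).symm

/-- The equality `q ∘ (tw(s) × t) = s ∘ q'`, as a 2-cell. -/
def cellQ : twProd s t ⋙ piQ I J ⟶ piQ I' J' ⋙ s where
  app _ := 𝟙 _
  naturality _ _ _ := (Category.comp_id _).trans (Category.id_comp _).symm

/-- The equality `t ∘ r' = r ∘ (tw(s) × t)`, as a 2-cell. -/
def cellR : piR I' J' ⋙ t ⟶ twProd s t ⋙ piR I J where
  app _ := 𝟙 _
  naturality _ _ _ := (Category.comp_id _).trans (Category.id_comp _).symm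

/-- The canonical comparison `Ψ : (sᵒᵖ × t)^* ⟦A, B⟧ ⟶ ⟦s^* A, t^* B⟧`, the composite
`(sᵒᵖ × t)^* p_*[q^* A, r^* B] ⟶ p'_* (tw(s) × t)^* [q^* A, r^* B]
  ⟶ p'_* [(tw(s) × t)^* q^* A, (tw(s) × t)^* r^* B] ≅ p'_* [q'^* s^* A, r'^* t^* B]`. -/
noncomputable def Psi (A : D.obj I) (B : D.obj J) :
    (D.pull (opProd s t)).obj (D.ehom A B) ⟶
      D.ehom ((D.pull s).obj A) ((D.pull t).obj B) :=
  (D.baseChangeR (cellP s t)).app _ ≫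
    (D.pushR (piP I' J')).map
      (ihomComparison (D.pull (twProd s t)) _ _ ≫
        ihomMap ((D.square (cellQ s t)).app A) ((D.square (cellR s t)).app B))

end Psi

section Fiber

variable {I J : Dia.Obj} (i : I) (j : J)

/-- The object `(1_i, j)` of `tw(I) × J`. -/
def idPoint : (I.tw.prod J).carrier := (⟨i, i, 𝟙 i⟩, j)

/-- The equality `(i, j) = p ∘ (1_i, j)`, as a 2-cell. -/
def pointCellP : Obj.at (I := I.tw.prod J) (idPoint i j) ⋙ piP I J ⟶
    Obj.at (I := I.opp.prod J) (op i, j) where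
  app _ := 𝟙 _
  naturality _ _ _ := (Category.comp_id _).trans (Category.id_comp _).symm

/-- The equality `q ∘ (1_i, j) = i`, as a 2-cell. -/
def pointCellQ : Obj.at (I := I.tw.prod J) (idPoint i j) ⋙ piQ I J ⟶ Obj.at i where
  app _ := 𝟙 _
  naturality _ _ _ := (Category.comp_id _).trans (Category.id_comp _).symm

/-- The equality `j = r ∘ (1_i, j)`, as a 2-cell. -/
def pointCellR : Obj.at j ⟶ Obj.at (I := I.tw.prod J) (idPoint i j) ⋙ piR I J where
  app _ := 𝟙 _
  naturality _ _ _ := (Category.comp_id _).trans (Category.id_comp _).symm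

/-- The canonical morphism `⟦A, B⟧_{(i, j)} ⟶ [A_i, B_j]`. With `x = (1_i, j)` it is the composite
`(i, j)^* p_*[q^* A, r^* B] ≅ x^* p^* p_*[q^* A, r^* B] ⟶ x^*[q^* A, r^* B]
  ⟶ [x^* q^* A, x^* r^* B] ≅ [i^* A, j^* B]`. -/
noncomputable def fiberComparison (A : D.obj I) (B : D.obj J) :
    (D.fiber (I := I.opp.prod J) (op i, j)).obj (D.ehom A B) ⟶
      (ihom ((D.fiber i).obj A)).obj ((D.fiber j).obj B) :=
  (D.pull₂ (pointCellP i j) ≫ (D.pullComp _ _).hom).app (D.ehom A B) ≫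
    (D.fiber (idPoint i j)).map ((D.adjR (piP I J)).counit.app _) ≫
    ihomComparison (D.fiber (idPoint i j)) _ _ ≫
    ihomMap ((D.pull₂ (pointCellQ i j) ≫ (D.pullComp _ _).hom).app A)
      (((D.pullComp _ _).inv ≫ D.pull₂ (pointCellR i j)).app B)

end Fiber

end ClosedMonoidalDerivator

end ExternalHom

/-! It suffices to treat fibers: each fiber of Ψ is carried by canonical isomorphisms to a fiber
comparison for `A`, `B`, so two-out-of-three and (D2) reduce the invertibility of Ψ to that of
$[\![A,B]\!]_{(i,j)}\to[A_i,B_j]$.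

For the latter let K be the comma category of p over (i,j), with projection s to tw(I) × J. By (D4)
the fiber of $p_*$ at (i,j) is $p_{K*}s^*$. Moreover $s^*$ commutes with internal homs
(`ihomComparison_overProj_isIso`). By adjunction this amounts to the projection formula
$s_\#(s^*A\otimes C)\cong A\otimes s_\#C$, which is tested on fibers. There (D4) turns $s_\#$ into
$p_\#$ for n\K, and the difference from (M) is a morphism that becomes invertible on the objects of
n\K whose structure morphism is an isomorphism. These compute $p_\#$, because n\K retracts onto them
by an endofunctor with a 2-cell to the identity.

Hence morphisms $C\to[\![A,B]\!]_{(i,j)}$ are the morphisms $s^*q^*A\otimes p_K^*C\to s^*r^*B$ over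
K. An object of K is a chain i → a → b with j' → j. Composing the chain and replacing j' by j gives
an endofunctor T of K and a zigzag from the identity through T to the constant functor at (1_i, j).
The first cell does not move b, so it is inverted by the source; the second does not move j, so it
is inverted by the target. Thus such morphisms are determined freely by their restriction to (1_i,
j) (`fiber_map_bijective`), which is a morphism $A_i\otimes C\to B_j$.

That these bijections induce the canonical morphism itself is checked on transposes: both
comparisons arise by restricting the evaluation $q^*A\otimes p^*[\![A,B]\!]\to r^*B$, and `pairing`
and `squarePairing` provide the pasting calculus for such restrictions. -/

namespace ExternalHom

open DiagramCategory Functor.LaxMonoidal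

/-! ### Pasting calculus for 2-cells in a prederivator -/

namespace Prederivator

variable {Dia : DiagramCategory.{w}} (D : Prederivator.{w, v, u} Dia)

instance isIso_pull₂ {I J : Dia.Obj} {f g : I ⥤ J} (η : f ⟶ g) [IsIso η] : IsIso (D.pull₂ η) :=
  ⟨D.pull₂ (inv η), by rw [← D.pull₂_comp, IsIso.inv_hom_id, D.pull₂_id],
    by rw [← D.pull₂_comp, IsIso.hom_inv_id, D.pull₂_id]⟩

/-- The morphism `y^* A ⟶ w^* p^* A` induced by a 2-cell `w ≫ p ⟶ y`. -/
def cellIn {L X Y : Dia.Obj} {w : L ⥤ X} {p : X ⥤ Y} {y : L ⥤ Y} (α : w ⋙ p ⟶ y) (A : D.obj Y) :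
    (D.pull y).obj A ⟶ (D.pull w).obj ((D.pull p).obj A) :=
  (D.pull₂ α).app A ≫ (D.pullComp w p).hom.app A

/-- The morphism `w^* p^* A ⟶ y^* A` induced by a 2-cell `y ⟶ w ≫ p`. -/
def cellOut {L X Y : Dia.Obj} {w : L ⥤ X} {p : X ⥤ Y} {y : L ⥤ Y} (γ : y ⟶ w ⋙ p) (A : D.obj Y) :
    (D.pull w).obj ((D.pull p).obj A) ⟶ (D.pull y).obj A :=
  (D.pullComp w p).inv.app A ≫ (D.pull₂ γ).app A

section

variable {L L' X Y : Dia.Obj} {w w' : L ⥤ X} {p : X ⥤ Y} {y y' : L ⥤ Y}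

instance (α : w ⋙ p ⟶ y) (A : D.obj Y) [IsIso ((D.pull₂ α).app A)] : IsIso (D.cellIn α A) := by
  unfold cellIn; infer_instance

instance (γ : y ⟶ w ⋙ p) (A : D.obj Y) [IsIso ((D.pull₂ γ).app A)] : IsIso (D.cellOut γ A) := by
  unfold cellOut; infer_instance

theorem cellIn_naturality (α : w ⋙ p ⟶ y) {A B : D.obj Y} (f : A ⟶ B) :
    (D.pull y).map f ≫ D.cellIn α B = D.cellIn α A ≫ (D.pull w).map ((D.pull p).map f) :=
  (D.pull₂ α ≫ (D.pullComp w p).hom).naturality f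

/-- Composition of functors is associative up to definitional equality, so the associator in
`pull_assoc` is an identity 2-cell and its image drops out. The two unit lemmas below hold for the
same reason. -/
theorem pullComp_assoc {I J K M : Dia.Obj} (a : I ⥤ J) (t : J ⥤ K) (s : K ⥤ M) (A : D.obj M) :
    (D.pullComp (a ⋙ t) s).hom.app A ≫ (D.pullComp a t).hom.app ((D.pull s).obj A) =
      (D.pullComp a (t ⋙ s)).hom.app A ≫ (D.pull a).map ((D.pullComp t s).hom.app A) := by
  refine (D.pull_assoc a t s A).trans ?_
  have h : (D.pull₂ (Functor.associator a t s).inv).app A = 𝟙 _ :=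
    congrArg (fun τ => τ.app A) (D.pull₂_id (a ⋙ t ⋙ s))
  exact (congrArg (· ≫ _) h).trans (Category.id_comp _)

theorem pullComp_id_left {I J : Dia.Obj} (a : I ⥤ J) (A : D.obj J) :
    (D.pullComp (𝟭 I) a).hom.app A ≫ (D.pullId I).hom.app ((D.pull a).obj A) = 𝟙 _ :=
  (D.pull_id_comp a A).trans (congrArg (fun τ => τ.app A) (D.pull₂_id a))

theorem pullComp_id_right {I J : Dia.Obj} (a : I ⥤ J) (A : D.obj J) :
    (D.pullComp a (𝟭 J)).hom.app A ≫ (D.pull a).map ((D.pullId J).hom.app A) = 𝟙 _ :=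
  (D.pull_comp_id a A).trans (congrArg (fun τ => τ.app A) (D.pull₂_id a))

theorem pull₂_whiskerRight_app {I J K : Dia.Obj} {a b : I ⥤ J} (η : a ⟶ b) (t : J ⥤ K)
    (A : D.obj K) :
    (D.pull₂ (Functor.whiskerRight η t)).app A ≫ (D.pullComp a t).hom.app A =
      (D.pullComp b t).hom.app A ≫ (D.pull₂ η).app ((D.pull t).obj A) :=
  congrArg (fun τ => τ.app A) (D.pull₂_whiskerRight η t)

theorem pull₂_whiskerLeft_app {I J K : Dia.Obj} (a : I ⥤ J) {t t' : J ⥤ K} (θ : t ⟶ t')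
    (A : D.obj K) :
    (D.pull₂ (Functor.whiskerLeft a θ)).app A ≫ (D.pullComp a t).hom.app A =
      (D.pullComp a t').hom.app A ≫ (D.pull a).map ((D.pull₂ θ).app A) :=
  congrArg (fun τ => τ.app A) (D.pull₂_whiskerLeft a θ)

theorem pull₂_comp_app {I J : Dia.Obj} {a b c : I ⥤ J} (η : a ⟶ b) (θ : b ⟶ c) (A : D.obj J) :
    (D.pull₂ (η ≫ θ)).app A = (D.pull₂ θ).app A ≫ (D.pull₂ η).app A :=
  congrArg (fun τ => τ.app A) (D.pull₂_comp η θ)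

theorem cellIn_app (α : w ⋙ p ⟶ y) (A : D.obj Y) :
    D.cellIn α A = (D.pull₂ α).app A ≫ (D.pullComp w p).hom.app A := rfl

theorem cellOut_app (γ : y ⟶ w ⋙ p) (A : D.obj Y) :
    D.cellOut γ A = (D.pullComp w p).inv.app A ≫ (D.pull₂ γ).app A := rfl

theorem cellIn_comp (α : w ⋙ p ⟶ y) (δ : y ⟶ y') (A : D.obj Y) :
    D.cellIn (α ≫ δ) A = (D.pull₂ δ).app A ≫ D.cellIn α A := by
  rw [cellIn_app, cellIn_app, pull₂_comp_app, Category.assoc]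

theorem cellOut_comp (γ : y ⟶ w ⋙ p) (δ : y' ⟶ y) (A : D.obj Y) :
    D.cellOut (δ ≫ γ) A = D.cellOut γ A ≫ (D.pull₂ δ).app A := by
  rw [cellOut_app, cellOut_app, pull₂_comp_app, Category.assoc]

theorem cellIn_whiskerRight (θ : w' ⟶ w) (α : w ⋙ p ⟶ y) (A : D.obj Y) :
    D.cellIn (Functor.whiskerRight θ p ≫ α) A =
      D.cellIn α A ≫ (D.pull₂ θ).app ((D.pull p).obj A) := by
  rw [cellIn_app, cellIn_app, pull₂_comp_app, Category.assoc, Category.assoc,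
    pull₂_whiskerRight_app]

theorem cellOut_whiskerRight (θ : w' ⟶ w) (γ : y ⟶ w' ⋙ p) (A : D.obj Y) :
    D.cellOut (γ ≫ Functor.whiskerRight θ p) A =
      (D.pull₂ θ).app ((D.pull p).obj A) ≫ D.cellOut γ A := by
  rw [cellOut_app, cellOut_app, pull₂_comp_app, ← Category.assoc, ← Category.assoc]
  congr 1
  rw [← cancel_epi ((D.pullComp w p).hom.app A), Iso.hom_inv_id_app_assoc, ← Category.assoc,
    ← pull₂_whiskerRight_app, Category.assoc, Iso.hom_inv_id_app]
  exact (Category.comp_id _).symm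

theorem cellIn_whiskerLeft (z : L' ⥤ L) (α : w ⋙ p ⟶ y) (A : D.obj Y) :
    D.cellIn (w := z ⋙ w) (p := p) (y := z ⋙ y) (Functor.whiskerLeft z α) A ≫
        (D.pullComp z w).hom.app ((D.pull p).obj A) =
      (D.pullComp z y).hom.app A ≫ (D.pull z).map (D.cellIn α A) := by
  rw [cellIn_app, cellIn_app, Category.assoc, pullComp_assoc, Functor.map_comp,
    ← Category.assoc, ← Category.assoc]
  exact congrArg (· ≫ _) (D.pull₂_whiskerLeft_app z α A)

theorem cellOut_whiskerLeft (z : L' ⥤ L) (γ : y ⟶ w ⋙ p) (A : D.obj Y) :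
    D.cellOut (w := z ⋙ w) (p := p) (y := z ⋙ y) (Functor.whiskerLeft z γ) A ≫
        (D.pullComp z y).hom.app A =
      (D.pullComp z w).hom.app ((D.pull p).obj A) ≫ (D.pull z).map (D.cellOut γ A) := by
  rw [cellOut_app, cellOut_app, Functor.map_comp, Category.assoc,
    ← cancel_epi ((D.pullComp (z ⋙ w) p).hom.app A), Iso.hom_inv_id_app_assoc]
  refine (D.pull₂_whiskerLeft_app z γ A).trans ?_
  rw [← Category.assoc, ← Category.assoc, pullComp_assoc]
  refine congrArg (· ≫ _) ?_
  rw [Category.assoc, ← Functor.map_comp, Iso.hom_inv_id_app, CategoryTheory.Functor.map_id]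
  exact (Category.comp_id _).symm

/-- Composing the cells of two triangles over `z : L' ⥤ L` and `o : Y ⥤ Z`. -/
theorem cellIn_paste {Z : Dia.Obj} {q : X ⥤ Z} {p' : L ⥤ Y} {o : Y ⥤ Z} (z : L' ⥤ L) {y : L' ⥤ Y}
    (α : w ⋙ q ⟶ p' ⋙ o) (α' : z ⋙ p' ⟶ y) (A : D.obj Z) :
    D.cellIn α' ((D.pull o).obj A) ≫
        (D.pull z).map ((D.pullComp p' o).inv.app A ≫ D.cellIn α A) =
      (D.pullComp y o).inv.app A ≫
        (D.cellIn (w := z ⋙ w) (p := q)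
          (Functor.whiskerLeft z α ≫ Functor.whiskerRight α' o) A) ≫
        (D.pullComp z w).hom.app ((D.pull q).obj A) := by
  rw [← cancel_epi ((D.pullComp y o).hom.app A), Iso.hom_inv_id_app_assoc]
  have h1 := D.cellIn_comp (w := z ⋙ w) (p := q) (y := z ⋙ p' ⋙ o)
    (Functor.whiskerLeft z α) (Functor.whiskerRight α' o) A
  refine Eq.trans ?_ (congrArg (· ≫ _) h1).symm
  refine Eq.trans ?_ (Category.assoc _ _ _).symm
  refine Eq.trans ?_ (congrArg (_ ≫ ·) (D.cellIn_whiskerLeft z α A)).symm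
  rw [cellIn_app, Category.assoc, ← Category.assoc, ← pull₂_whiskerRight_app, Category.assoc]
  refine congrArg (_ ≫ ·) ?_
  rw [← Category.assoc, pullComp_assoc, Category.assoc, ← Functor.map_comp,
    Iso.hom_inv_id_app_assoc]

theorem cellOut_paste {Z : Dia.Obj} {q : X ⥤ Z} {p' : L ⥤ Y} {o : Y ⥤ Z} (z : L' ⥤ L) {y : L' ⥤ Y}
    (γ : p' ⋙ o ⟶ w ⋙ q) (γ' : y ⟶ z ⋙ p') (A : D.obj Z) :
    (D.pull z).map (D.cellOut γ A ≫ (D.pullComp p' o).hom.app A) ≫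
        D.cellOut γ' ((D.pull o).obj A) =
      (D.pullComp z w).inv.app ((D.pull q).obj A) ≫
        (D.cellOut (w := z ⋙ w) (p := q)
          (Functor.whiskerRight γ' o ≫ Functor.whiskerLeft z γ) A) ≫
        (D.pullComp y o).hom.app A := by
  rw [← cancel_epi ((D.pullComp z w).hom.app ((D.pull q).obj A)), Iso.hom_inv_id_app_assoc]
  have h1 := D.cellOut_comp (w := z ⋙ w) (p := q) (y := z ⋙ p' ⋙ o)
    (Functor.whiskerLeft z γ) (Functor.whiskerRight γ' o) A
  refine Eq.trans ?_ (congrArg (· ≫ _) h1).symm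
  refine Eq.trans ?_ (Category.assoc _ _ _).symm
  rw [pull₂_whiskerRight_app, Functor.map_comp, ← Category.assoc, ← Category.assoc,
    ← cellOut_whiskerLeft, ← Category.assoc, Category.assoc, Category.assoc]
  rw [← Category.assoc ((D.pullComp z (p' ⋙ o)).hom.app A), ← pullComp_assoc, cellOut_app _ γ']
  simp only [Category.assoc, Iso.hom_inv_id_app_assoc]

end

/-! ### Contraction arguments: restriction to a point and left Kan extension -/

/-- The canonical isomorphism of a fiber functor with itself after a restriction to a constant
diagram. -/
def constIso (K : Dia.Obj) (k : K) : 𝟭 (D.obj Dia.pt) ≅ D.pull K.toPt ⋙ D.fiber k :=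
  (D.pullId Dia.pt).symm ≪≫ D.pullComp (Obj.at k) K.toPt

/-- The two cells agree at `k`, so whiskered with the inclusion of `k` they are the same 2-cell. The
rest is coherence of `pullComp` with `pullId`. -/
theorem fiber_map_cellIn_toPt {K : Dia.Obj} {k : K} {T : K ⥤ K} (ζ : K.toPt ⋙ Obj.at k ⟶ T)
    (η : 𝟭 K.carrier ⟶ T)
    (h : η.app k = ζ.app k) (A : D.obj K) :
    (D.fiber k).map (D.cellIn ζ A) ≫ (D.constIso K k).inv.app ((D.fiber k).obj A) =
      (D.fiber k).map ((D.pull₂ η).app A ≫ (D.pullId K).hom.app A) := by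
  have e : Functor.whiskerLeft (Obj.at k) ζ = Functor.whiskerLeft (Obj.at k) η := by
    ext x
    exact h.symm
  have h1 := D.cellIn_whiskerLeft (Obj.at k) ζ A
  have h2 : (D.pullComp (Obj.at k) K.toPt).hom.app ((D.fiber k).obj A) ≫
      (D.constIso K k).inv.app ((D.fiber k).obj A) = (D.pullId Dia.pt).hom.app _ :=
    Iso.hom_inv_id_app_assoc (D.pullComp (Obj.at k) K.toPt) _ _
  have h3 := D.pullComp_id_left (Obj.at k) A
  have h4 := D.pullComp_id_right (Obj.at k) A
  have h5 := D.pull₂_whiskerLeft_app (Obj.at k) η A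
  rw [← cancel_epi ((D.pullComp (Obj.at k) T).hom.app A), ← Category.assoc, ← h1,
    Functor.map_comp, ← Category.assoc ((D.pullComp (Obj.at k) T).hom.app A), ← h5,
    e]
  refine Eq.trans ?_ ((Category.assoc _ _ _).trans (congrArg (_ ≫ ·) h4)).symm
  refine ((Category.assoc _ _ _).trans (congrArg (_ ≫ ·) h2)).trans ?_
  exact (Category.assoc _ _ _).trans (congrArg (_ ≫ ·) h3)

/-- Restriction to the fiber at `k` is bijective on morphisms `X ⟶ W`, if an endofunctor `T` of `K`
is connected with the identity by a 2-cell inverted by `X` and with the constant functor at `k`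
by a 2-cell inverted by `W`. -/
theorem fiber_map_bijective {K : Dia.Obj} {k : K} {T : K ⥤ K} (η : 𝟭 K.carrier ⟶ T)
    (ζ : K.toPt ⋙ Obj.at k ⟶ T) (h : η.app k = ζ.app k) (X W : D.obj K)
    [IsIso ((D.pull₂ η).app X)] [IsIso ((D.pull₂ ζ).app W)] :
    Function.Bijective fun f : X ⟶ W => (D.fiber k).map f := by
  have hX := D.fiber_map_cellIn_toPt ζ η h X
  have hW := D.fiber_map_cellIn_toPt ζ η h W
  set a : ∀ A, (D.pull T).obj A ⟶ A := fun A => (D.pull₂ η).app A ≫ (D.pullId K).hom.app A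
  have ha : ∀ {A B} (f : A ⟶ B), a A ≫ f = (D.pull T).map f ≫ a B := fun {A B} f =>
    ((D.pull₂ η ≫ (D.pullId K).hom).naturality f).symm
  have : IsIso (a X) := inferInstanceAs (IsIso (_ ≫ _))
  -- Naturality along both legs of the zigzag forces this formula for `f` in terms of its fiber `g`.
  -- Since `a X` is invertible, the formula also defines an `f` for every `g`, and the agreement of
  -- the legs at `k` shows that its fiber is `g`.
  have key : ∀ g : (D.fiber k).obj X ⟶ (D.fiber k).obj W, ∀ f : X ⟶ W,
      a X ≫ f = D.cellIn ζ X ≫ (D.pull K.toPt).map g ≫ inv (D.cellIn ζ W) ≫ a W ↔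
        (D.fiber k).map f = g := by
    intro g f
    have hζ := D.cellIn_naturality ζ f
    constructor
    · intro e
      have e' := congrArg (fun φ => (D.fiber k).map φ) e
      simp only [Functor.map_comp, Functor.map_inv] at e'
      have hc := (D.constIso K k).inv.naturality g
      rw [← cancel_epi ((D.fiber k).map (a X)), e', ← hX, ← hW, IsIso.inv_hom_id_assoc,
        Category.assoc]
      exact congrArg (_ ≫ ·) hc
    · rintro rfl
      refine (ha f).trans ((congrArg (· ≫ a W) ((IsIso.eq_comp_inv _).2 hζ)).trans ?_)
      simp only [Category.assoc]
  constructor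
  · intro f f' e
    exact (cancel_epi (a X)).1 (((key _ f).2 rfl).trans ((key _ f').2 e.symm).symm)
  · intro g
    refine ⟨inv (a X) ≫ D.cellIn ζ X ≫ (D.pull K.toPt).map g ≫
      inv (D.cellIn ζ W) ≫ a W, (key g _).1 ?_⟩
    rw [IsIso.hom_inv_id_assoc]

/-- By adjunction, precomposition with `f` must be bijective on morphisms into $p^*E$. The 2-cell θ
induces $1\to T^*$, which is invertible on $p^*E$, so a morphism into $p^*E$ is recovered from its
image under $T^*$, where `f` is invertible. -/
theorem pushL_map_isIso [D.HasKanExtensions] {K L : Dia.Obj} (p : K ⥤ L) {T : K ⥤ K}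
    (θ : T ⟶ 𝟭 K.carrier) [IsIso (Functor.whiskerRight θ p)] {X Y : D.obj K} (f : X ⟶ Y)
    [IsIso ((D.pull T).map f)] : IsIso ((D.pushL p).map f) := by
  let a : 𝟭 (D.obj K) ⟶ D.pull T := (D.pullId K).inv ≫ D.pull₂ θ
  have ha : ∀ E, IsIso (a.app ((D.pull p).obj E)) := fun E => by
    have h := D.pull₂_whiskerRight_app θ p E
    have : IsIso ((D.pull₂ θ).app ((D.pull p).obj E)) := by
      have h' := (Iso.inv_comp_eq ((D.pullComp (𝟭 K.carrier) p).app E)).2 h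
      rw [← h']
      infer_instance
    exact inferInstanceAs (IsIso (_ ≫ _))
  have nat : ∀ {A B : D.obj K} (g : A ⟶ B), g ≫ a.app B = a.app A ≫ (D.pull T).map g :=
    fun g => a.naturality g
  rw [isIso_iff_coyoneda_map_bijective]
  intro E
  have hE := ha E
  have hf : ∀ g : X ⟶ (D.pull p).obj E, f ≫ a.app Y ≫ inv ((D.pull T).map f) ≫
      (D.pull T).map g ≫ inv (a.app ((D.pull p).obj E)) = g := fun g => by
    rw [← Category.assoc, nat f, Category.assoc, IsIso.hom_inv_id_assoc, ← Category.assoc,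
      ← nat g, Category.assoc, IsIso.hom_inv_id, Category.comp_id]
  have hb : Function.Bijective fun g : Y ⟶ (D.pull p).obj E => f ≫ g := by
    constructor
    · intro g g' e
      have h1 := congrArg (fun φ => (D.pull T).map φ) e
      simp only [Functor.map_comp, cancel_epi] at h1
      rw [← cancel_mono (a.app ((D.pull p).obj E))]
      exact (nat g).trans ((congrArg (a.app Y ≫ ·) h1).trans (nat g').symm)
    · exact fun g => ⟨_, hf g⟩
  have e : (fun g : (D.pushL p).obj Y ⟶ E => (D.pushL p).map f ≫ g) =
      ((D.adjL p).homEquiv _ _).symm ∘ (fun g => f ≫ g) ∘ ((D.adjL p).homEquiv _ _) := by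
    funext g
    simp [Adjunction.homEquiv_naturality_left_symm]
  rw [e]
  exact (Equiv.bijective _).comp (hb.comp (Equiv.bijective _))

theorem pull_map_pull₂_isIso {I J K : Dia.Obj} (T : I ⥤ J) {a b : J ⥤ K} (α : a ⟶ b)
    [IsIso (Functor.whiskerLeft T α)] (A : D.obj K) : IsIso ((D.pull T).map ((D.pull₂ α).app A)) := by
  have h := (Iso.inv_comp_eq ((D.pullComp T b).app A)).2 (D.pull₂_whiskerLeft_app T α A)
  rw [← h]
  infer_instance

theorem pull_map_square_isIso {K K' L L' M : Dia.Obj} {g : K' ⥤ K} {k' : K' ⥤ L'} {k : K ⥤ L}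
    {f : L' ⥤ L} (α : k' ⋙ f ⟶ g ⋙ k) (T : M ⥤ K') [IsIso (Functor.whiskerLeft T α)]
    (A : D.obj L) : IsIso ((D.pull T).map ((D.square α).app A)) := by
  have := D.pull_map_pull₂_isIso T α A
  simp only [square, NatTrans.comp_app, Functor.map_comp]
  infer_instance

/-- The unit formula for mates; together with its counit analogue below it allows Beck–Chevalley
morphisms to be compared through their transposes. -/
theorem homEquiv_baseChangeL [D.HasKanExtensions] {K K' L L' : Dia.Obj} {g : K' ⥤ K} {k' : K' ⥤ L'}
    {k : K ⥤ L} {f : L' ⥤ L} (α : k' ⋙ f ⟶ g ⋙ k) (X : D.obj K) :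
    (D.adjL k').homEquiv ((D.pull g).obj X) ((D.pull f).obj ((D.pushL k).obj X))
        ((D.baseChangeL α).app X) =
      (D.pull g).map ((D.adjL k).unit.app X) ≫ (D.square α).app ((D.pushL k).obj X) := by
  rw [Adjunction.homEquiv_unit]
  exact (unit_mateEquiv_symm (D.adjL k) (D.adjL k') (TwoSquare.mk _ _ _ _ (D.square α)) X).symm

theorem homEquiv_symm_baseChangeR [D.HasKanExtensions] {K K' L L' : Dia.Obj} {g : K' ⥤ K}
    {k' : K' ⥤ L'} {k : K ⥤ L} {f : L' ⥤ L} (α : g ⋙ k ⟶ k' ⋙ f) (X : D.obj K) :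
    ((D.adjR k').homEquiv ((D.pull f).obj ((D.pushR k).obj X)) ((D.pull g).obj X)).symm
        ((D.baseChangeR α).app X) =
      (D.square α).app ((D.pushR k).obj X) ≫ (D.pull g).map ((D.adjR k).counit.app X) := by
  rw [Adjunction.homEquiv_counit]
  exact mateEquiv_counit (D.adjR k) (D.adjR k') (TwoSquare.mk _ _ _ _ (D.square α)) X

end Prederivator

/-! ### Tensor products and the projection morphism -/

namespace ClosedMonoidalPrederivator

variable {Dia : DiagramCategory.{w}} (D : ClosedMonoidalPrederivator.{w, v, u} Dia)

theorem μ_pull₂ {I J : Dia.Obj} {a b : I ⥤ J} (η : a ⟶ b) (A B : D.obj J) :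
    μ (D.pull b) A B ≫ (D.pull₂ η).app (A ⊗ B) =
      ((D.pull₂ η).app A ⊗ₘ (D.pull₂ η).app B) ≫ μ (D.pull a) A B :=
  (D.pull₂_isMonoidal η).tensor A B

theorem μ_pullComp {I J K : Dia.Obj} (a : I ⥤ J) (b : J ⥤ K) (A B : D.obj K) :
    μ (D.pull (a ⋙ b)) A B ≫ (D.pullComp a b).hom.app (A ⊗ B) =
      ((D.pullComp a b).hom.app A ⊗ₘ (D.pullComp a b).hom.app B) ≫
        μ (D.pull a) _ _ ≫ (D.pull a).map (μ (D.pull b) A B) :=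
  (D.pullComp_isMonoidal a b).tensor A B

theorem μ_pullComp_inv {I J K : Dia.Obj} (a : I ⥤ J) (b : J ⥤ K) (A B : D.obj K) :
    μ (D.pull a) _ _ ≫ (D.pull a).map (μ (D.pull b) A B) ≫ (D.pullComp a b).inv.app (A ⊗ B) =
      ((D.pullComp a b).inv.app A ⊗ₘ (D.pullComp a b).inv.app B) ≫ μ (D.pull (a ⋙ b)) A B := by
  rw [← cancel_mono ((D.pullComp a b).hom.app (A ⊗ B)), Category.assoc, Category.assoc,
    Category.assoc, μ_pullComp, Iso.inv_hom_id_app, tensorHom_comp_tensorHom_assoc,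
    Iso.inv_hom_id_app, Iso.inv_hom_id_app]
  simp

theorem μ_square {K K' L L' : Dia.Obj} {g : K' ⥤ K} {k' : K' ⥤ L'} {k : K ⥤ L}
    {f : L' ⥤ L} (α : k' ⋙ f ⟶ g ⋙ k) (A B : D.obj L) :
    μ (D.pull g) _ _ ≫ (D.pull g).map (μ (D.pull k) A B) ≫ (D.square α).app (A ⊗ B) =
      ((D.square α).app A ⊗ₘ (D.square α).app B) ≫ μ (D.pull k') _ _ ≫
        (D.pull k').map (μ (D.pull f) A B) := by
  have h := D.μ_pullComp_inv g k A B
  simp only [Prederivator.square, NatTrans.comp_app, ← tensorHom_comp_tensorHom, Category.assoc]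
  rw [← μ_pullComp, reassoc_of% h, reassoc_of% (D.μ_pull₂ α A B)]

/-- The projection morphism `u_#(u^* A ⊗ B) ⟶ A ⊗ u_# B`. -/
noncomputable def projection [D.HasKanExtensions] {I J : Dia.Obj} (a : I ⥤ J) (A : D.obj J)
    (B : D.obj I) :
    (D.pushL a).obj ((D.pull a).obj A ⊗ B) ⟶ A ⊗ (D.pushL a).obj B :=
  ((D.adjL a).homEquiv _ _).symm
    ((D.pull a).obj A ◁ (D.adjL a).unit.app B ≫ μ (D.pull a) A ((D.pushL a).obj B))

theorem unit_projection [D.HasKanExtensions] {I J : Dia.Obj} (a : I ⥤ J) (A : D.obj J)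
    (B : D.obj I) :
    (D.adjL a).unit.app _ ≫ (D.pull a).map (D.projection a A B) =
      (D.pull a).obj A ◁ (D.adjL a).unit.app B ≫ μ (D.pull a) A ((D.pushL a).obj B) := by
  exact ((D.adjL a).homEquiv_unit _ _ _).symm.trans (Equiv.apply_symm_apply _ _)

/-- Taking φ to be the unit recovers the definition of `projection`; the general case follows by
naturality of μ. -/
theorem homEquiv_symm_whiskerLeft_μ [D.HasKanExtensions] {I J : Dia.Obj} (a : I ⥤ J) (A C : D.obj J)
    (B : D.obj I) (φ : B ⟶ (D.pull a).obj C) :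
    ((D.adjL a).homEquiv _ _).symm ((D.pull a).obj A ◁ φ ≫ μ (D.pull a) A C) =
      D.projection a A B ≫ A ◁ ((D.adjL a).homEquiv _ _).symm φ := by
  rw [Equiv.symm_apply_eq, Adjunction.homEquiv_unit, Functor.map_comp, ← Category.assoc,
    unit_projection, Category.assoc, ← μ_natural_right, ← whiskerLeft_comp_assoc]
  have h := ((D.adjL a).homEquiv_unit _ _ (((D.adjL a).homEquiv _ _).symm φ)).symm
  rw [Equiv.apply_symm_apply] at h
  exact congrArg (fun f => (D.pull a).obj A ◁ f ≫ μ (D.pull a) A C) h.symm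

end ClosedMonoidalPrederivator

/-! ### The projection formula for projections from slices -/

namespace ClosedMonoidalDerivator

variable {Dia : DiagramCategory.{w}} (D : ClosedMonoidalDerivator.{w, v, u} Dia)

/-- The projection formula holds for `s` if, for every `n`, an endofunctor of `n\K` with a 2-cell
to the identity factors through the objects with invertible structure morphism. -/
theorem projection_isIso_of_retract {K N : Dia.Obj} (s : K ⥤ N)
    (h : ∀ n : N, ∃ (T : StructuredArrow n s ⥤ StructuredArrow n s) (_ : T ⟶ 𝟭 _),
      ∀ x, IsIso (T.obj x).hom) (A : D.obj N) (B : D.obj K) :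
    IsIso (D.projection s A B) := by
  apply Prederivator.IsDerivator.conservative (D := D.toPrederivator)
  intro n
  obtain ⟨T, θ, hT⟩ := h n
  let t : Obj.under s n ⥤ K := Obj.underProj s n
  let p := (Obj.under s n).toPt
  let α := Prederivator.underCell s n
  let sq (Z : D.obj N) : (D.pull t).obj ((D.pull s).obj Z) ⟶
      (D.pull p).obj ((D.fiber n).obj Z) := (D.square α).app Z
  let bc (X : D.obj K) : (D.pushL p).obj ((D.pull t).obj X) ⟶
      (D.fiber n).obj ((D.pushL s).obj X) := (D.baseChangeL α).app X
  have hbc (X : D.obj K) : IsIso (bc X) := by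
    have := Prederivator.IsDerivator.under_isIso (D := D.toPrederivator) s n
    exact inferInstanceAs (IsIso ((D.baseChangeL α).app X))
  let un (X : D.obj K) : X ⟶ (D.pull s).obj ((D.pushL s).obj X) := (D.adjL s).unit.app X
  -- Up to Beck–Chevalley isomorphisms, the fiber at `n` of the projection morphism of `s` is that
  -- of `p`, preceded by the comparison `sq A` of $t^*s^*A$ with the constant diagram $p^*n^*A$.
  -- Only the factor containing `sq A` is not invertible for formal reasons or by (M). The identity
  -- is checked on transposes under $p_\#\dashv p^*$.
  have key : bc _ ≫ (D.fiber n).map (D.projection s A B) =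
      (D.pushL p).map (inv (μ (D.pull t) _ _)) ≫ (D.pushL p).map (sq A ▷ (D.pull t).obj B) ≫
        D.projection p _ _ ≫ (D.fiber n).obj A ◁ bc B ≫ μ (D.fiber n) _ _ := by
    let φ (X : D.obj K) : (D.pull t).obj X ⟶ (D.pull p).obj ((D.fiber n).obj ((D.pushL s).obj X)) :=
      (D.pull t).map (un X) ≫ sq ((D.pushL s).obj X)
    have e (X : D.obj K) : (D.adjL p).homEquiv _ _ (bc X) = φ X := D.homEquiv_baseChangeL α X
    have e3 : un _ ≫ (D.pull s).map (D.projection s A B) =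
        (D.pull s).obj A ◁ un B ≫ μ (D.pull s) _ _ := D.unit_projection s A B
    have e4 : (D.pull t).map ((D.pull s).map (D.projection s A B)) ≫ sq _ =
      sq _ ≫ (D.pull p).map ((D.fiber n).map (D.projection s A B)) :=
      (D.square α).naturality (D.projection s A B)
    have e5 : μ (D.pull t) _ _ ≫ (D.pull t).map (μ (D.pull s) A ((D.pushL s).obj B)) ≫ sq _ =
        (sq A ⊗ₘ sq _) ≫ μ (D.pull p) _ _ ≫ (D.pull p).map (μ (D.fiber n) A _) :=
      D.μ_square α A ((D.pushL s).obj B)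
    have e6 := D.homEquiv_symm_whiskerLeft_μ p ((D.fiber n).obj A) _ _ (φ B)
    rw [← e B, Equiv.symm_apply_apply, e B] at e6
    apply ((D.adjL p).homEquiv _ _).injective
    rw [Adjunction.homEquiv_naturality_right, e, Adjunction.homEquiv_naturality_left,
      Adjunction.homEquiv_naturality_left, ← Category.assoc (D.projection p _ _),
      Adjunction.homEquiv_naturality_right, ← e6, Equiv.apply_symm_apply, IsIso.eq_inv_comp]
    have e7 : φ ((D.pull s).obj A ⊗ B) ≫ (D.pull p).map ((D.fiber n).map (D.projection s A B)) =
        (D.pull t).map ((D.pull s).obj A ◁ un B) ≫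
          (D.pull t).map (μ (D.pull s) A ((D.pushL s).obj B)) ≫ sq _ := by
      rw [Category.assoc, ← e4, ← Functor.map_comp_assoc, e3, Functor.map_comp_assoc]
    rw [e7, ← μ_natural_right_assoc, e5, MonoidalCategory.tensorHom_def, whiskerLeft_comp]
    simp only [Category.assoc]
    rw [whisker_exchange_assoc]
  -- `sq A` itself need not be invertible, but $T^*$ inverts it: the component of `α` at `T.obj x`
  -- is the structure morphism of `T.obj x`. The condition on θ is automatic, as `p` maps to the
  -- terminal category.
  have h1 : IsIso ((D.pushL p).map (sq A ▷ (D.pull t).obj B)) := by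
    have : IsIso (Functor.whiskerRight θ p) := by
      have (x : StructuredArrow n s) : IsIso ((Functor.whiskerRight θ p).app x) :=
        inferInstanceAs (IsIso (C := Discrete PUnit) _)
      exact NatIso.isIso_of_isIso_app _
    have : IsIso (Functor.whiskerLeft T α) := by
      have (x : StructuredArrow n s) : IsIso ((Functor.whiskerLeft T α).app x) := hT x
      exact NatIso.isIso_of_isIso_app _
    have : IsIso ((D.pull (I := Obj.under s n) (J := Obj.under s n) T).map
        (sq A ▷ (D.pull t).obj B)) := by
      have := D.pull_map_square_isIso (M := Obj.under s n) α T A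
      rw [Functor.Monoidal.map_whiskerRight]
      infer_instance
    exact D.pushL_map_isIso (K := Obj.under s n) p θ _
  have h2 : IsIso (D.projection p ((D.fiber n).obj A) ((D.pull t).obj B)) :=
    D.projection_isIso _ _ _
  have h3 : IsIso (bc _ ≫ (D.fiber n).map (D.projection s A B)) := by
    rw [key]
    infer_instance
  exact IsIso.of_isIso_comp_left (bc _) _

end ClosedMonoidalDerivator

/-- The endofunctor of `n\(F/l)` sending `n ⟶ k` to the identity of `n`, over `F n ⟶ F k ⟶ l`. -/
def underSliceRetract {N M : Type w} [Category.{w} N] [Category.{w} M] (F : N ⥤ M) (l : M) (n : N) :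
    StructuredArrow n (CostructuredArrow.proj F l) ⥤
      StructuredArrow n (CostructuredArrow.proj F l) where
  obj x := StructuredArrow.mk (S := n) (T := CostructuredArrow.proj F l)
    (Y := CostructuredArrow.mk (F.map (show n ⟶ x.right.left from x.hom) ≫ x.right.hom)) (𝟙 n)
  map {x y} f := StructuredArrow.homMk (CostructuredArrow.homMk (𝟙 n) (by
    have h1 : (show n ⟶ x.right.left from x.hom) ≫ f.right.left = y.hom := StructuredArrow.w f
    have h2 : F.map f.right.left ≫ y.right.hom = x.right.hom := CostructuredArrow.w f.right
    change F.map (𝟙 n) ≫ F.map (show n ⟶ y.right.left from y.hom) ≫ y.right.hom =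
      F.map (show n ⟶ x.right.left from x.hom) ≫ x.right.hom
    rw [← h1, F.map_comp, Category.assoc, h2, F.map_id, Category.id_comp])) (Category.comp_id _)
  map_id _ := rfl
  map_comp _ _ := StructuredArrow.ext _ _ (CostructuredArrow.ext _ _ (Category.id_comp _).symm)

/-- The canonical transformation from `underSliceRetract` to the identity. -/
def underSliceRetractHom {N M : Type w} [Category.{w} N] [Category.{w} M] (F : N ⥤ M) (l : M)
    (n : N) : underSliceRetract F l n ⟶ 𝟭 _ where
  app x := StructuredArrow.homMk
    (CostructuredArrow.homMk (show n ⟶ x.right.left from x.hom) rfl) (Category.id_comp _)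
  naturality x y f := by
    have h1 : (show n ⟶ x.right.left from x.hom) ≫ f.right.left = y.hom := StructuredArrow.w f
    apply StructuredArrow.ext
    apply CostructuredArrow.ext
    exact (Category.id_comp _).trans h1.symm

/-! ### Internal homs under inverse image, and restriction of pairings -/

theorem uncurry_comp_ihomComparison {C : Type u} [Category.{v} C] [MonoidalCategory C]
    [MonoidalClosed C] {E : Type u} [Category.{v} E] [MonoidalCategory E] [MonoidalClosed E]
    (F : C ⥤ E) [F.Monoidal] (A B : C) {X : E} (f : X ⟶ F.obj ((ihom A).obj B)) :
    MonoidalClosed.uncurry (f ≫ ihomComparison F A B) =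
      F.obj A ◁ f ≫ μ F A ((ihom A).obj B) ≫ F.map ((ihom.ev A).app B) := by
  rw [MonoidalClosed.uncurry_natural_left, ihomComparison, MonoidalClosed.uncurry_curry]

theorem uncurry_comp_ihomMap {C : Type u} [Category.{v} C] [MonoidalCategory C] [MonoidalClosed C]
    {A A' B B' : C} (a : A' ⟶ A) (b : B ⟶ B') {X : C} (f : X ⟶ (ihom A).obj B) :
    MonoidalClosed.uncurry (f ≫ ihomMap a b) = a ▷ X ≫ MonoidalClosed.uncurry f ≫ b := by
  rw [ihomMap, ← Category.assoc, MonoidalClosed.uncurry_pre_app,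
    MonoidalClosed.uncurry_natural_right]

namespace ClosedMonoidalPrederivator

variable {Dia : DiagramCategory.{w}} (D : ClosedMonoidalPrederivator.{w, v, u} Dia)

/-- The comparison is the conjugate of the projection morphism: under the adjunctions $a_\#\dashv
a^*$ and tensor-hom, composing with the former on morphisms out of `C` becomes precomposing with the
latter on morphisms into `B`. -/
theorem ihomComparison_isIso [D.HasKanExtensions] {I J : Dia.Obj} (a : I ⥤ J) (A B : D.obj J)
    (h : ∀ C, IsIso (D.projection a A C)) : IsIso (ihomComparison (D.pull a) A B) := by
  rw [isIso_iff_yoneda_map_bijective]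
  intro C
  have hb : Function.Bijective fun g : A ⊗ (D.pushL a).obj C ⟶ B => D.projection a A C ≫ g :=
    (isIso_iff_coyoneda_map_bijective _).1 (h C) B
  have e : (fun f : C ⟶ (D.pull a).obj ((ihom A).obj B) => f ≫ ihomComparison (D.pull a) A B) =
      ((ihom.adjunction _).homEquiv _ _) ∘ ((D.adjL a).homEquiv _ _) ∘
        (fun g => D.projection a A C ≫ g) ∘ ((ihom.adjunction A).homEquiv _ _).symm ∘
          ((D.adjL a).homEquiv _ _).symm := by
    funext f
    obtain ⟨g, rfl⟩ := ((D.adjL a).homEquiv _ _).surjective f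
    simp only [Function.comp_apply, Equiv.symm_apply_apply]
    rw [← Equiv.symm_apply_eq]
    have h1 := D.unit_projection a A C
    refine (uncurry_comp_ihomComparison (D.pull a) A B _).trans ?_
    have h2 : ((ihom.adjunction A).homEquiv _ _).symm g = A ◁ g ≫ (ihom.ev A).app B :=
      MonoidalClosed.uncurry_eq g
    refine Eq.trans ?_ ((D.adjL a).homEquiv_unit _ _ _).symm
    rw [h2, Adjunction.homEquiv_unit, Functor.map_comp, Functor.map_comp]
    refine Eq.trans ?_ ((congrArg (· ≫ _) h1.symm).trans (Category.assoc _ _ _))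
    rw [whiskerLeft_comp, Category.assoc, Category.assoc, μ_natural_right_assoc]
  rw [e]
  exact (Equiv.bijective _).comp ((Equiv.bijective _).comp (hb.comp
    ((Equiv.bijective _).comp (Equiv.bijective _))))

/-- The morphism `a^* A ⊗ y^* P ⟶ b^* B` obtained by restricting a morphism
`q^* A ⊗ p^* P ⟶ r^* B` along `w`, for 2-cells `w ≫ p ⟶ y`, `w ≫ q ⟶ a` and `b ⟶ w ≫ r`. -/
def pairing {L X Y I J : Dia.Obj} {w : L ⥤ X} {p : X ⥤ Y} {q : X ⥤ I} {r : X ⥤ J}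
    {y : L ⥤ Y} {a : L ⥤ I} {b : L ⥤ J} {P : D.obj Y} {A : D.obj I} {B : D.obj J}
    (ε : (D.pull q).obj A ⊗ (D.pull p).obj P ⟶ (D.pull r).obj B)
    (α : w ⋙ p ⟶ y) (β : w ⋙ q ⟶ a) (γ : b ⟶ w ⋙ r) :
    (D.pull a).obj A ⊗ (D.pull y).obj P ⟶ (D.pull b).obj B :=
  (D.cellIn β A ⊗ₘ D.cellIn α P) ≫ μ (D.pull w) _ _ ≫ (D.pull w).map ε ≫ D.cellOut γ B

section

variable {L X Y I J : Dia.Obj} {w w' : L ⥤ X} {p : X ⥤ Y} {q : X ⥤ I} {r : X ⥤ J}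
    {y y' : L ⥤ Y} {a a' : L ⥤ I} {b b' : L ⥤ J} {P P' : D.obj Y} {A : D.obj I} {B : D.obj J}
    (ε : (D.pull q).obj A ⊗ (D.pull p).obj P ⟶ (D.pull r).obj B)

theorem pairing_comp (α : w ⋙ p ⟶ y) (β : w ⋙ q ⟶ a) (γ : b ⟶ w ⋙ r)
    (α' : y ⟶ y') (β' : a ⟶ a') (γ' : b' ⟶ b) :
    D.pairing ε (α ≫ α') (β ≫ β') (γ' ≫ γ) =
      ((D.pull₂ β').app A ⊗ₘ (D.pull₂ α').app P) ≫ D.pairing ε α β γ ≫ (D.pull₂ γ').app B := by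
  simp only [pairing, Prederivator.cellIn_comp, Prederivator.cellOut_comp,
    ← tensorHom_comp_tensorHom, Category.assoc]

/-- A 2-cell between the functors restricted along can be moved from the two arguments to the value,
because `pull₂ θ` is natural and monoidal. -/
theorem pairing_whiskerRight (θ : w' ⟶ w) (α : w ⋙ p ⟶ y) (β : w ⋙ q ⟶ a) (γ : b ⟶ w' ⋙ r) :
    D.pairing ε (Functor.whiskerRight θ p ≫ α) (Functor.whiskerRight θ q ≫ β) γ =
      D.pairing ε α β (γ ≫ Functor.whiskerRight θ r) := by
  simp only [pairing, Prederivator.cellIn_whiskerRight, Prederivator.cellOut_whiskerRight,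
    ← tensorHom_comp_tensorHom, Category.assoc]
  rw [← reassoc_of% D.μ_pull₂ θ, ← (D.pull₂ θ).naturality_assoc]

theorem whiskerLeft_comp_pairing (α : w ⋙ p ⟶ y) (β : w ⋙ q ⟶ a) (γ : b ⟶ w ⋙ r) (f : P' ⟶ P) :
    (D.pull a).obj A ◁ (D.pull y).map f ≫ D.pairing ε α β γ =
      D.pairing ((D.pull q).obj A ◁ (D.pull p).map f ≫ ε) α β γ := by
  have h := D.cellIn_naturality α f
  rw [pairing, pairing, Functor.map_comp, Category.assoc, ← μ_natural_right_assoc,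
    ← id_tensorHom, ← id_tensorHom, tensorHom_comp_tensorHom_assoc, tensorHom_comp_tensorHom_assoc,
    h, Category.id_comp, Category.comp_id]

end

end ClosedMonoidalPrederivator

namespace ClosedMonoidalDerivator

variable {Dia : DiagramCategory.{w}} (D : ClosedMonoidalDerivator.{w, v, u} Dia)

theorem ihomComparison_overProj_isIso {N M : Dia.Obj} (F : N ⥤ M) (l : M) (A B : D.obj N) :
    IsIso (ihomComparison (D.pull (Obj.overProj F l)) A B) :=
  D.ihomComparison_isIso _ A B fun C =>
    D.projection_isIso_of_retract (Obj.overProj F l)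
      (fun n => ⟨underSliceRetract F l n, underSliceRetractHom F l n,
        fun _ => inferInstanceAs (IsIso (𝟙 n))⟩) A C

end ClosedMonoidalDerivator

namespace Prederivator

variable {Dia : DiagramCategory.{w}} (D : Prederivator.{w, v, u} Dia)

/-- The components of `square`. -/
abbrev squareApp {K K' L L' : Dia.Obj} {g : K' ⥤ K} {k' : K' ⥤ L'} {k : K ⥤ L} {f : L' ⥤ L}
    (α : k' ⋙ f ⟶ g ⋙ k) (A : D.obj L) :
    (D.pull g).obj ((D.pull k).obj A) ⟶ (D.pull k').obj ((D.pull f).obj A) :=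
  (D.square α).app A

end Prederivator

namespace ClosedMonoidalPrederivator

variable {Dia : DiagramCategory.{w}} (D : ClosedMonoidalPrederivator.{w, v, u} Dia)

/-- The morphism `q'^* a^* A ⊗ p'^* y^* P ⟶ r'^* b^* B` obtained by restricting a morphism
`q^* A ⊗ p^* P ⟶ r^* B` along `w`. -/
def squarePairing {L X Y Y' I I' J J' : Dia.Obj} {w : L ⥤ X} {p : X ⥤ Y} {q : X ⥤ I} {r : X ⥤ J}
    {p' : L ⥤ Y'} {q' : L ⥤ I'} {r' : L ⥤ J'}
    {y : Y' ⥤ Y} {a : I' ⥤ I} {b : J' ⥤ J} {P : D.obj Y} {A : D.obj I} {B : D.obj J}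
    (ε : (D.pull q).obj A ⊗ (D.pull p).obj P ⟶ (D.pull r).obj B)
    (α : w ⋙ p ⟶ p' ⋙ y) (β : w ⋙ q ⟶ q' ⋙ a) (γ : r' ⋙ b ⟶ w ⋙ r) :
    (D.pull q').obj ((D.pull a).obj A) ⊗ (D.pull p').obj ((D.pull y).obj P) ⟶
      (D.pull r').obj ((D.pull b).obj B) :=
  (D.squareApp β A ⊗ₘ D.squareApp α P) ≫ μ (D.pull w) _ _ ≫ (D.pull w).map ε ≫ D.squareApp γ B

/-- Restricting along `w` and then along `z` is restricting along `z ⋙ w` with the pasted cells.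
Each argument and the value are pasted separately, and monoidality of `pullComp` joins them. -/
theorem pairing_squarePairing {M L X Y Y' I I' J J' : Dia.Obj} {w : L ⥤ X} {p : X ⥤ Y} {q : X ⥤ I}
    {r : X ⥤ J} {p' : L ⥤ Y'} {q' : L ⥤ I'} {r' : L ⥤ J'}
    {y : Y' ⥤ Y} {a : I' ⥤ I} {b : J' ⥤ J} {P : D.obj Y} {A : D.obj I} {B : D.obj J}
    (ε : (D.pull q).obj A ⊗ (D.pull p).obj P ⟶ (D.pull r).obj B)
    (α : w ⋙ p ⟶ p' ⋙ y) (β : w ⋙ q ⟶ q' ⋙ a) (γ : r' ⋙ b ⟶ w ⋙ r)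
    {z : M ⥤ L} {y' : M ⥤ Y'} {a' : M ⥤ I'} {b' : M ⥤ J'}
    (α' : z ⋙ p' ⟶ y') (β' : z ⋙ q' ⟶ a') (γ' : b' ⟶ z ⋙ r') :
    D.pairing (D.squarePairing ε α β γ) α' β' γ' =
      ((D.pullComp a' a).inv.app A ⊗ₘ (D.pullComp y' y).inv.app P) ≫
        D.pairing (w := z ⋙ w) ε
          (Functor.whiskerLeft z α ≫ Functor.whiskerRight α' y :)
          (Functor.whiskerLeft z β ≫ Functor.whiskerRight β' a :)
          (Functor.whiskerRight γ' b ≫ Functor.whiskerLeft z γ :) ≫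
        (D.pullComp b' b).hom.app B := by
  have h1 : D.cellIn α' _ ≫ (D.pull z).map (D.squareApp α P) = _ := D.cellIn_paste z α α' P
  have h2 : D.cellIn β' _ ≫ (D.pull z).map (D.squareApp β A) = _ := D.cellIn_paste z β β' A
  have h3 : (D.pull z).map (D.squareApp γ B) ≫ D.cellOut γ' _ =
      (D.pullComp z w).inv.app ((D.pull r).obj B) ≫ D.cellOut (w := z ⋙ w) (p := r)
        (Functor.whiskerRight γ' b ≫ Functor.whiskerLeft z γ :) B ≫
          (D.pullComp b' b).hom.app B := by
    have h0 : D.squareApp γ B = D.cellOut γ B ≫ (D.pullComp r' b).hom.app B :=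
      (Category.assoc _ _ _).symm
    rw [h0]
    exact D.cellOut_paste z γ γ' B
  have h4 := D.μ_pullComp z w ((D.pull q).obj A) ((D.pull p).obj P)
  have h5 : (D.pullComp z w).hom.app _ ≫ (D.pull z).map ((D.pull w).map ε) ≫
      (D.pullComp z w).inv.app _ = (D.pull (z ⋙ w)).map ε := by
    rw [← Category.assoc]
    refine (congrArg (· ≫ _) ((D.pullComp z w).hom.naturality ε).symm).trans ?_
    rw [Category.assoc, Iso.hom_inv_id_app]
    exact Category.comp_id _
  rw [pairing, squarePairing, Functor.map_comp, Functor.map_comp, Functor.map_comp, Category.assoc,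
    Category.assoc, Category.assoc, h3, ← μ_natural_assoc, tensorHom_comp_tensorHom_assoc, h1, h2,
    ← tensorHom_comp_tensorHom_assoc, ← tensorHom_comp_tensorHom_assoc, pairing]
  simp only [Category.assoc]
  refine congrArg (_ ≫ ·) (congrArg (_ ≫ ·) ?_)
  rw [← h5]
  simp only [← Category.assoc]
  refine congrArg (· ≫ _) (congrArg (· ≫ _) (congrArg (· ≫ _) (congrArg (· ≫ _) ?_)))
  rw [h4, Category.assoc]

end ClosedMonoidalPrederivator

/-- Both Ψ (after passing to the counit) and `fiberComparison` have the shape on the left; the right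
side exhibits their transposes as restrictions of the pairing `uncurry c`. -/
theorem uncurry_comp_map_comp_ihomComparison {C : Type u} [Category.{v} C] [MonoidalCategory C]
    [MonoidalClosed C] {E : Type u} [Category.{v} E] [MonoidalCategory E] [MonoidalClosed E]
    (F : C ⥤ E) [F.Monoidal] {A B P : C} {A' B' X : E} (a : A' ⟶ F.obj A) (b : F.obj B ⟶ B')
    (c : P ⟶ (ihom A).obj B) (g : X ⟶ F.obj P) :
    MonoidalClosed.uncurry (((g ≫ F.map c) ≫ ihomComparison F A B) ≫ ihomMap a b) =
      (a ⊗ₘ g) ≫ μ F A P ≫ F.map (MonoidalClosed.uncurry c) ≫ b := by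
  rw [uncurry_comp_ihomMap, uncurry_comp_ihomComparison, MonoidalClosed.uncurry_eq c,
    Functor.map_comp, whiskerLeft_comp, MonoidalCategory.tensorHom_def]
  simp only [Category.assoc]
  rw [μ_natural_right_assoc]

/-! ### Comparison morphisms as restrictions of the evaluation -/

namespace ClosedMonoidalDerivator

variable {Dia : DiagramCategory.{w}} (D : ClosedMonoidalDerivator.{w, v, u} Dia)

/-- The counit `p^* ⟦A, B⟧ ⟶ [q^* A, r^* B]`. -/
noncomputable def ehomCounit {I J : Dia.Obj} (A : D.obj I) (B : D.obj J) :
    (D.pull (piP I J)).obj (D.ehom A B) ⟶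
      (ihom ((D.pull (piQ I J)).obj A)).obj ((D.pull (piR I J)).obj B) :=
  (D.adjR (piP I J)).counit.app _

/-- The evaluation `q^* A ⊗ p^* ⟦A, B⟧ ⟶ r^* B`. -/
noncomputable def evaluation {I J : Dia.Obj} (A : D.obj I) (B : D.obj J) :
    (D.pull (piQ I J)).obj A ⊗ (D.pull (piP I J)).obj (D.ehom A B) ⟶ (D.pull (piR I J)).obj B :=
  MonoidalClosed.uncurry (D.ehomCounit A B)

theorem uncurry_comp_fiberComparison {I J : Dia.Obj} (i : I) (j : J) (A : D.obj I) (B : D.obj J)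
    {X : D.obj Dia.pt} (f : X ⟶ (D.fiber (I := I.opp.prod J) (op i, j)).obj (D.ehom A B)) :
    MonoidalClosed.uncurry (f ≫ D.fiberComparison i j A B) =
      (D.fiber i).obj A ◁ f ≫ D.pairing (D.evaluation A B) (pointCellP i j) (pointCellQ i j)
        (pointCellR i j) := by
  let x := Obj.at (I := I.tw.prod J) (idPoint i j)
  have h : D.fiberComparison i j A B =
      ((D.cellIn (pointCellP i j) _ ≫ (D.pull x).map (D.ehomCounit A B)) ≫
        ihomComparison (D.pull x) _ _) ≫
        ihomMap (D.cellIn (pointCellQ i j) A) (D.cellOut (pointCellR i j) B) := by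
    simp only [Category.assoc]
    rfl
  rw [MonoidalClosed.uncurry_natural_left, h, uncurry_comp_map_comp_ihomComparison]
  rfl

theorem whiskerLeft_Psi_comp_evaluation {I I' J J' : Dia.Obj} (s : I' ⥤ I) (t : J' ⥤ J)
    (A : D.obj I) (B : D.obj J) :
    (D.pull (piQ I' J')).obj ((D.pull s).obj A) ◁ (D.pull (piP I' J')).map (D.Psi s t A B) ≫
      D.evaluation ((D.pull s).obj A) ((D.pull t).obj B) =
    D.squarePairing (D.evaluation A B) (cellP s t) (cellQ s t) (cellR s t) := by
  let w' := twProd s t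
  have h : (D.pull (piP I' J')).map (D.Psi s t A B) ≫ D.ehomCounit _ _ =
      ((D.squareApp (cellP s t) _ ≫ (D.pull w').map (D.ehomCounit A B)) ≫
        ihomComparison (D.pull w') _ _) ≫
        ihomMap (D.squareApp (cellQ s t) A) (D.squareApp (cellR s t) B) := by
    -- Composing with the counit after $p'^*$ is transposition under $p'^*\dashv p'_*$, which undoes
    -- the mate in the first factor of Ψ.
    have h1 := D.homEquiv_symm_baseChangeR (cellP s t)
      ((ihom ((D.pull (piQ I J)).obj A)).obj ((D.pull (piR I J)).obj B))
    refine ((D.adjR (piP I' J')).homEquiv_counit _ _ _).symm.trans ?_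
    refine ((D.adjR (piP I' J')).homEquiv_naturality_right_symm _ _).trans ?_
    exact (congrArg (· ≫ _) h1).trans (Category.assoc _ _ _).symm
  rw [evaluation, ← MonoidalClosed.uncurry_natural_left, h, uncurry_comp_map_comp_ihomComparison]
  rfl

end ClosedMonoidalDerivator

/-! ### Objects that invert a 2-cell, and pairings at a point -/

namespace Prederivator

variable {Dia : DiagramCategory.{w}} (D : Prederivator.{w, v, u} Dia)

theorem squareApp_id {L X Y : Dia.Obj} (s : L ⥤ X) (q : X ⥤ Y) (A : D.obj Y) :
    D.squareApp (𝟙 (s ⋙ q)) A = 𝟙 _ := by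
  simp only [squareApp, square, D.pull₂_id, Category.id_comp, Iso.inv_hom_id]
  rfl

theorem pull₂_app_isIso_of_iso {I J : Dia.Obj} {a b : I ⥤ J} (η : a ⟶ b) {X Y : D.obj J} (e : X ≅ Y)
    [IsIso ((D.pull₂ η).app X)] : IsIso ((D.pull₂ η).app Y) := by
  have h := (D.pull₂ η).naturality e.hom
  rw [← IsIso.eq_inv_comp] at h
  rw [h]
  infer_instance

theorem pull₂_app_pull_isIso {I J K : Dia.Obj} {a b : I ⥤ J} (η : a ⟶ b) (t : J ⥤ K)
    [IsIso (Functor.whiskerRight η t)] (A : D.obj K) :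
    IsIso ((D.pull₂ η).app ((D.pull t).obj A)) := by
  have h := (Iso.inv_comp_eq ((D.pullComp b t).app A)).2 (D.pull₂_whiskerRight_app η t A)
  rw [← h]
  infer_instance

theorem pull₂_app_pull_pull_isIso {I J K M : Dia.Obj} {a b : I ⥤ J} (η : a ⟶ b) (t : J ⥤ K)
    (t' : K ⥤ M) [IsIso (Functor.whiskerRight η (t ⋙ t'))] (A : D.obj M) :
    IsIso ((D.pull₂ η).app ((D.pull t).obj ((D.pull t').obj A))) := by
  have := D.pull₂_app_pull_isIso η (t ⋙ t') A
  exact D.pull₂_app_isIso_of_iso η ((D.pullComp t t').app A)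

end Prederivator

theorem ihomMap_id {C : Type u} [Category.{v} C] [MonoidalCategory C] [MonoidalClosed C] (A B : C) :
    ihomMap (𝟙 A) (𝟙 B) = 𝟙 _ := by
  simp [ihomMap, MonoidalClosed.pre_id]

namespace ClosedMonoidalPrederivator

variable {Dia : DiagramCategory.{w}} (D : ClosedMonoidalPrederivator.{w, v, u} Dia)

theorem pull₂_app_tensor_isIso {I J : Dia.Obj} {a b : I ⥤ J} (η : a ⟶ b) (A B : D.obj J)
    [IsIso ((D.pull₂ η).app A)] [IsIso ((D.pull₂ η).app B)] :
    IsIso ((D.pull₂ η).app (A ⊗ B)) := by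
  have h := D.μ_pull₂ η A B
  rw [← IsIso.eq_inv_comp] at h
  rw [h]
  infer_instance

/-- This links the canonical morphism with the chain of bijections: pairing directly at the point
`s.obj k` agrees with pairing over all of `K` and then taking the fiber at `k`. The isomorphisms do
not depend on `f`, as the Yoneda argument requires. -/
theorem exists_iso_pairing_eq_fiber_map {K X Y I J : Dia.Obj} (s : K ⥤ X) (k : K) {p : X ⥤ Y}
    {q : X ⥤ I} {r : X ⥤ J} {y : Dia.pt ⥤ Y} (α : s ⋙ p ⟶ K.toPt ⋙ y) {a : Dia.pt ⥤ I}
    {b : Dia.pt ⥤ J} (β : (Obj.at k ⋙ s) ⋙ q ⟶ a) [IsIso β] (γ : b ⟶ (Obj.at k ⋙ s) ⋙ r) [IsIso γ]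
    {P : D.obj Y} {A : D.obj I} {B : D.obj J}
    (ε : (D.pull q).obj A ⊗ (D.pull p).obj P ⟶ (D.pull r).obj B) (C : D.obj Dia.pt) :
    ∃ (e₁ : (D.pull a).obj A ⊗ C ≅ (D.fiber k).obj ((D.pull s).obj ((D.pull q).obj A) ⊗
        (D.pull K.toPt).obj C))
      (e₂ : (D.fiber k).obj ((D.pull s).obj ((D.pull r).obj B)) ≅ (D.pull b).obj B),
      ∀ f : C ⟶ (D.pull y).obj P,
        (D.pull a).obj A ◁ f ≫ D.pairing (w := Obj.at k ⋙ s) ε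
          (show (Obj.at k ⋙ s) ⋙ p ⟶ y from Functor.whiskerLeft (Obj.at k) α) β γ =
        e₁.hom ≫ (D.fiber k).map (_ ◁ (D.pull K.toPt).map f ≫
          D.squarePairing ε α (𝟙 (s ⋙ q)) (𝟙 (s ⋙ r))) ≫ e₂.hom := by
  let δ : Obj.at k ⋙ K.toPt ⟶ 𝟭 Dia.pt.carrier := 𝟙 _
  have : IsIso δ := inferInstanceAs (IsIso (𝟙 (𝟭 Dia.pt.carrier)))
  let α₀ : (Obj.at k ⋙ s) ⋙ p ⟶ y := Functor.whiskerLeft (Obj.at k) α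
  let e₁ := (asIso (D.cellIn β A) ⊗ᵢ (D.pullId Dia.pt).symm.app C) ≪≫
    (asIso (D.cellIn (𝟙 (Obj.at k ⋙ s)) ((D.pull q).obj A)) ⊗ᵢ asIso (D.cellIn δ C)) ≪≫
      Functor.Monoidal.μIso (D.fiber k) _ _
  let e₂ := asIso (D.cellOut (𝟙 (Obj.at k ⋙ s)) ((D.pull r).obj B)) ≪≫ asIso (D.cellOut γ B)
  refine ⟨e₁, e₂, fun f => ?_⟩
  have h1 := D.whiskerLeft_comp_pairing (D.squarePairing ε α (𝟙 (s ⋙ q)) (𝟙 (s ⋙ r))) δ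
      (𝟙 (Obj.at k ⋙ s)) (𝟙 (Obj.at k ⋙ s)) f
  have h2 : D.pairing (D.squarePairing ε α (𝟙 (s ⋙ q)) (𝟙 (s ⋙ r))) δ
      (𝟙 (Obj.at k ⋙ s)) (𝟙 (Obj.at k ⋙ s)) =
      ((D.pullComp (Obj.at k ⋙ s) q).inv.app A ⊗ₘ (D.pullComp (𝟭 Dia.pt.carrier) y).inv.app P) ≫
        D.pairing (w := Obj.at k ⋙ s) ε α₀ (𝟙 _) (𝟙 _) ≫
          (D.pullComp (Obj.at k ⋙ s) r).hom.app B := by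
    refine (D.pairing_squarePairing ε α (𝟙 (s ⋙ q)) (𝟙 (s ⋙ r)) δ
      (𝟙 (Obj.at k ⋙ s)) (𝟙 (Obj.at k ⋙ s))).trans ?_
    have e1 : (Functor.whiskerLeft (Obj.at k) α ≫ Functor.whiskerRight δ y :
        Obj.at k ⋙ s ⋙ p ⟶ y) = α₀ := by
      ext x
      exact (congrArg (α.app k ≫ ·) (y.map_id _)).trans (Category.comp_id _)
    have e2 : (Functor.whiskerLeft (Obj.at k) (𝟙 (s ⋙ q)) ≫
        Functor.whiskerRight (𝟙 (Obj.at k ⋙ s)) q : Obj.at k ⋙ s ⋙ q ⟶ _) = 𝟙 _ := by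
      ext x
      exact (Category.id_comp _).trans (q.map_id _)
    have e3 : (Functor.whiskerRight (𝟙 (Obj.at k ⋙ s)) r ≫ Functor.whiskerLeft (Obj.at k)
        (𝟙 (s ⋙ r)) : Obj.at k ⋙ s ⋙ r ⟶ Obj.at k ⋙ s ⋙ r) = 𝟙 _ := by
      ext x
      exact (Category.comp_id _).trans (r.map_id _)
    exact congrArg (_ ≫ ·) (congrArg (· ≫ _) (congr (congr (congrArg (D.pairing ε) e1) e2) e3))
  have h3 : D.pairing (w := Obj.at k ⋙ s) ε α₀ β γ = ((D.pull₂ β).app A ▷ _) ≫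
      D.pairing (w := Obj.at k ⋙ s) ε α₀ (𝟙 _) (𝟙 _) ≫ (D.pull₂ γ).app B := by
    have := D.pairing_comp (w := Obj.at k ⋙ s) ε α₀ (𝟙 _) (𝟙 _) (𝟙 _) β γ
    rw [Category.comp_id, Category.id_comp, Category.comp_id, D.pull₂_id] at this
    refine this.trans (congrArg (· ≫ _) (tensorHom_id _ _))
  -- Restricting the constant diagram on `C` to `k` is pulling back along the identity of the point;
  -- unit coherence says that this returns `f`.
  have h4 : (D.pullId Dia.pt).inv.app C ≫ (D.pull (𝟭 Dia.pt.carrier)).map f ≫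
      (D.pullComp (𝟭 Dia.pt.carrier) y).inv.app P = f := by
    have hn : (D.pullId Dia.pt).inv.app C ≫ (D.pull (𝟭 Dia.pt.carrier)).map f =
        f ≫ (D.pullId Dia.pt).inv.app ((D.pull y).obj P) := ((D.pullId Dia.pt).inv.naturality f).symm
    have hi := D.pullComp_id_left y P
    have hi' : (D.pullId Dia.pt).inv.app ((D.pull y).obj P) =
        (D.pullComp (𝟭 Dia.pt.carrier) y).hom.app P := by
      rw [← cancel_mono ((D.pullId Dia.pt).hom.app ((D.pull y).obj P)), Iso.inv_hom_id_app]
      exact hi.symm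
    rw [← Category.assoc, hn, Category.assoc, hi', Iso.hom_inv_id_app]
    exact Category.comp_id f
  have h5 : D.cellIn β A ≫ (D.pullComp (Obj.at k ⋙ s) q).inv.app A = (D.pull₂ β).app A := by
    rw [Prederivator.cellIn_app, Category.assoc, Iso.hom_inv_id_app]
    exact Category.comp_id _
  have h6 : (D.pullComp (Obj.at k ⋙ s) r).hom.app B ≫ D.cellOut γ B = (D.pull₂ γ).app B := by
    rw [Prederivator.cellOut_app, Iso.hom_inv_id_app_assoc]
  have h7 : e₁.hom ≫ (D.fiber k).map (_ ◁ (D.pull K.toPt).map f ≫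
      D.squarePairing ε α (𝟙 (s ⋙ q)) (𝟙 (s ⋙ r))) ≫ e₂.hom =
      (D.cellIn β A ⊗ₘ (D.pullId Dia.pt).inv.app C) ≫
        (_ ◁ (D.pull (𝟭 Dia.pt.carrier)).map f ≫
          D.pairing (D.squarePairing ε α (𝟙 (s ⋙ q)) (𝟙 (s ⋙ r))) δ
            (𝟙 (Obj.at k ⋙ s)) (𝟙 (Obj.at k ⋙ s))) ≫ D.cellOut γ B := by
    rw [h1, pairing]
    simp only [e₁, e₂, Iso.trans_hom, Category.assoc]
    rfl
  refine Eq.trans ?_ h7.symm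
  rw [h2]
  refine (congrArg (_ ≫ ·) h3).trans ?_
  have h8 : (D.cellIn β A ⊗ₘ (D.pullId Dia.pt).inv.app C) ≫
      _ ◁ (D.pull (𝟭 Dia.pt.carrier)).map f ≫
        ((D.pullComp (Obj.at k ⋙ s) q).inv.app A ⊗ₘ
          (D.pullComp (𝟭 Dia.pt.carrier) y).inv.app P) =
      (D.pull a).obj A ◁ f ≫ (D.pull₂ β).app A ▷ (D.pull y).obj P := by
    rw [← id_tensorHom, ← id_tensorHom, ← tensorHom_id, tensorHom_comp_tensorHom,
      tensorHom_comp_tensorHom, tensorHom_comp_tensorHom, Category.id_comp, Category.id_comp,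
      Category.comp_id]
    exact congr (congrArg _ h5) h4
  rw [← Category.assoc, ← h8, ← h6]
  simp only [Category.assoc]

end ClosedMonoidalPrederivator

/-! ### The contraction of the comma category over (i, j) -/

/-- The endofunctor of the category over `(i, j)` sending `i ⟶ a ⟶ b`, `j' ⟶ j` to
`i = i ⟶ b`, `j = j`. -/
def overRetract {Dia : DiagramCategory.{w}} {I J : Dia.Obj} (i : I) (j : J) :
    Obj.over (piP I J) (op i, j) ⥤ Obj.over (piP I J) (op i, j) where
  obj x := CostructuredArrow.mk (S := piP I J)
    (Y := ((⟨i, x.left.1.tgt, x.hom.1.unop ≫ x.left.1.hom⟩, j) : (I.tw.prod J).carrier))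
    (𝟙 ((op i, j) : (I.opp.prod J).carrier))
  map {x y} f := CostructuredArrow.homMk (⟨𝟙 i, f.left.1.right, by
    have h1 := f.left.1.w
    have h2 : f.left.1.left.op ≫ y.hom.1 = x.hom.1 :=
      congrArg Prod.fst (CostructuredArrow.w f)
    have h3 : y.hom.1.unop ≫ f.left.1.left = x.hom.1.unop := congrArg Quiver.Hom.unop h2
    change 𝟙 i ≫ (x.hom.1.unop ≫ x.left.1.hom) ≫ f.left.1.right = y.hom.1.unop ≫ y.left.1.hom
    -- Stated for free variables, so that both hypotheses can be eliminated by substitution.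
    have aux : ∀ {a b c d e : I} (h : a ⟶ b) (l : b ⟶ c) (m : c ⟶ d) (r : d ⟶ e) (g : a ⟶ c)
        (n : b ⟶ e), h ≫ l = g → l ≫ m ≫ r = n → 𝟙 a ≫ (g ≫ m) ≫ r = h ≫ n := by
      rintro _ _ _ _ _ h l m r _ _ rfl rfl
      simp
    exact aux _ _ _ _ _ _ h3 h1⟩, 𝟙 j)
    (Category.comp_id _)
  map_id _ := rfl
  map_comp f g := CostructuredArrow.ext _ _ (Prod.ext
    (TwistedArrow.Hom.ext (Category.id_comp _).symm rfl) (Category.id_comp _).symm)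

/-- The canonical transformation from the identity to `overRetract`. -/
def toOverRetract {Dia : DiagramCategory.{w}} {I J : Dia.Obj} (i : I) (j : J) :
    𝟭 (Obj.over (piP I J) (op i, j)).carrier ⟶ overRetract i j where
  app x := CostructuredArrow.homMk (⟨x.hom.1.unop, 𝟙 _,
    congrArg (x.hom.1.unop ≫ ·) (Category.comp_id x.left.1.hom)⟩, x.hom.2) (Category.comp_id _)
  naturality x y f := by
    have h2 : f.left.1.left.op ≫ y.hom.1 = x.hom.1 :=
      congrArg Prod.fst (CostructuredArrow.w f)
    have h3 : y.hom.1.unop ≫ f.left.1.left = x.hom.1.unop := congrArg Quiver.Hom.unop h2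
    have h4 : f.left.2 ≫ y.hom.2 = x.hom.2 := congrArg Prod.snd (CostructuredArrow.w f)
    refine CostructuredArrow.ext _ _ (Prod.ext (TwistedArrow.Hom.ext ?_ ?_) ?_)
    · exact h3.trans (Category.id_comp _).symm
    · exact (Category.comp_id _).trans (Category.id_comp _).symm
    · exact h4.trans (Category.comp_id _).symm

/-- The object `(i, j) = (i, j)` of the category over `(i, j)`. -/
abbrev overPoint {Dia : DiagramCategory.{w}} {I J : Dia.Obj} (i : I) (j : J) :
    (Obj.over (piP I J) (op i, j)).carrier :=
  CostructuredArrow.mk (S := piP I J) (Y := ClosedMonoidalDerivator.idPoint i j)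
    (𝟙 ((op i, j) : (I.opp.prod J).carrier))

/-- The canonical transformation from the constant functor at `overPoint` to `overRetract`. -/
def overPointToRetract {Dia : DiagramCategory.{w}} {I J : Dia.Obj} (i : I) (j : J) :
    (Obj.over (piP I J) (op i, j)).toPt ⋙
      Obj.at (I := Obj.over (piP I J) (op i, j)) (overPoint i j) ⟶ overRetract i j where
  app x := CostructuredArrow.homMk (⟨𝟙 i, x.hom.1.unop ≫ x.left.1.hom,
    (Category.id_comp _).trans (Category.id_comp _)⟩, 𝟙 j) (Category.comp_id _)
  naturality x y f := by
    have h1 := f.left.1.w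
    have h2 : f.left.1.left.op ≫ y.hom.1 = x.hom.1 :=
      congrArg Prod.fst (CostructuredArrow.w f)
    have h3 : y.hom.1.unop ≫ f.left.1.left = x.hom.1.unop := congrArg Quiver.Hom.unop h2
    refine CostructuredArrow.ext _ _ (Prod.ext (TwistedArrow.Hom.ext rfl ?_) rfl)
    have aux : ∀ {a b c d e : I} (h : a ⟶ b) (l : b ⟶ c) (m : c ⟶ d) (r : d ⟶ e) (g : a ⟶ c)
        (n : b ⟶ e), h ≫ l = g → l ≫ m ≫ r = n → 𝟙 a ≫ h ≫ n = (g ≫ m) ≫ r := by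
      rintro _ _ _ _ _ h l m r _ _ rfl rfl
      simp
    exact aux _ _ _ _ _ _ h3 h1

theorem ihomMap_comp {C : Type u} [Category.{v} C] [MonoidalCategory C] [MonoidalClosed C]
    {A A' A'' B B' B'' : C} (a : A' ⟶ A) (b : B ⟶ B') (a' : A'' ⟶ A') (b' : B' ⟶ B'') :
    ihomMap a b ≫ ihomMap a' b' = ihomMap (a' ≫ a) (b ≫ b') := by
  simp [ihomMap, MonoidalClosed.pre_map]

instance {C : Type u} [Category.{v} C] [MonoidalCategory C] [MonoidalClosed C]
    {A A' B B' : C} (a : A' ⟶ A) (b : B ⟶ B') [IsIso a] [IsIso b] : IsIso (ihomMap a b) :=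
  ⟨ihomMap (inv a) (inv b), by simp [ihomMap_comp, ihomMap_id], by simp [ihomMap_comp, ihomMap_id]⟩

namespace ClosedMonoidalPrederivator

variable {Dia : DiagramCategory.{w}} (D : ClosedMonoidalPrederivator.{w, v, u} Dia)

theorem squarePairing_id_id {L X Y Y' I J : Dia.Obj} {w : L ⥤ X} {p : X ⥤ Y} {q : X ⥤ I}
    {r : X ⥤ J} {p' : L ⥤ Y'} {y : Y' ⥤ Y} {P : D.obj Y} {A : D.obj I} {B : D.obj J}
    (ε : (D.pull q).obj A ⊗ (D.pull p).obj P ⟶ (D.pull r).obj B) (α : w ⋙ p ⟶ p' ⋙ y) :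
    D.squarePairing ε α (𝟙 (w ⋙ q)) (𝟙 (w ⋙ r)) =
      (𝟙 _ ⊗ₘ D.squareApp α P) ≫ μ (D.pull w) _ _ ≫ (D.pull w).map ε ≫ 𝟙 _ := by
  rw [squarePairing, Prederivator.squareApp_id, Prederivator.squareApp_id]

end ClosedMonoidalPrederivator

/-! ### Fibers of the external hom, and invertibility of Ψ -/

namespace ClosedMonoidalDerivator

variable {Dia : DiagramCategory.{w}} (D : ClosedMonoidalDerivator.{w, v, u} Dia)

/-- By Yoneda: on morphisms out of `C`, composing with the comparison is the composite of the
bijections `b₁`, `b₂`, `b₃`, a conjugation by isomorphisms and currying. -/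
theorem fiberComparison_isIso {I J : Dia.Obj} (A : D.obj I) (B : D.obj J) (i : I) (j : J) :
    IsIso (D.fiberComparison i j A B) := by
  rw [isIso_iff_yoneda_map_bijective]
  intro C
  let K := Obj.over (piP I J) (op i, j)
  let s : K ⥤ I.tw.prod J := Obj.overProj (piP I J) (op i, j)
  let k : K := overPoint i j
  let α := Prederivator.overCell (piP I J) (op i, j)
  let P := D.ehom A B
  let y := Obj.at (I := I.opp.prod J) (op i, j)
  let G := (D.pull s).obj ((D.pull (piQ I J)).obj A)
  let W := (D.pull s).obj ((D.pull (piR I J)).obj B)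
  let β : (Obj.at k ⋙ s) ⋙ piQ I J ⟶ Obj.at i := pointCellQ i j
  let γ : Obj.at j ⟶ (Obj.at k ⋙ s) ⋙ piR I J := pointCellR i j
  have : IsIso β := inferInstanceAs (IsIso (𝟙 (Obj.at i)))
  have : IsIso γ := inferInstanceAs (IsIso (𝟙 (Obj.at j)))
  obtain ⟨e₁, e₂, he⟩ := D.exists_iso_pairing_eq_fiber_map s k α β γ (D.evaluation A B) C
  -- (D4) for the comma square over (i, j), transposed under $p_K^*\dashv p_{K*}$.
  have b₁ : Function.Bijective fun f : C ⟶ (D.pull y).obj P =>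
      (D.pull K.toPt).map f ≫ D.squareApp α P ≫ (D.pull s).map (D.ehomCounit A B) := by
    have h := D.homEquiv_symm_baseChangeR α
      ((ihom ((D.pull (piQ I J)).obj A)).obj ((D.pull (piR I J)).obj B))
    have hi : IsIso ((D.baseChangeR α).app
        ((ihom ((D.pull (piQ I J)).obj A)).obj ((D.pull (piR I J)).obj B))) := by
      have := Prederivator.IsDerivator.over_isIso (D := D.toPrederivator) (piP I J) (op i, j)
      infer_instance
    have hb := (isIso_iff_yoneda_map_bijective _).1 hi C
    have e : (fun f : C ⟶ (D.pull y).obj P =>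
        (D.pull K.toPt).map f ≫ D.squareApp α P ≫ (D.pull s).map (D.ehomCounit A B)) =
        ((D.adjR K.toPt).homEquiv _ _).symm ∘ fun f => f ≫ (D.baseChangeR α).app _ := by
      funext f
      exact (congrArg (_ ≫ ·) h.symm).trans
        ((D.adjR K.toPt).homEquiv_naturality_left_symm _ _).symm
    rw [e]
    exact (Equiv.bijective _).comp hb
  -- $s^*$ preserves the internal hom, and tensor-hom adjunction over `K` does the rest.
  have b₂ : Function.Bijective fun g : (D.pull K.toPt).obj C ⟶ (D.pull s).obj _ =>
      MonoidalClosed.uncurry (g ≫ ihomComparison (D.pull s) ((D.pull (piQ I J)).obj A)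
        ((D.pull (piR I J)).obj B)) := by
    have hb := (isIso_iff_yoneda_map_bijective _).1 (D.ihomComparison_overProj_isIso (piP I J)
      (op i, j) ((D.pull (piQ I J)).obj A) ((D.pull (piR I J)).obj B)) ((D.pull K.toPt).obj C)
    exact ((ihom.adjunction _).homEquiv _ _).symm.bijective.comp hb
  -- `toOverRetract` is the identity on targets of arrows, so it is inverted by `G`, which is pulled
  -- back along q, and by the constant diagram, hence by their tensor product. `overPointToRetract`
  -- is the identity on the `J`-component, so it is inverted by `W`, which is pulled back along r.
  have b₃ : Function.Bijective fun h : G ⊗ (D.pull K.toPt).obj C ⟶ W => (D.fiber k).map h := by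
    have : IsIso (Functor.whiskerRight (toOverRetract i j) (s ⋙ piQ I J)) := by
      have (x : K) : IsIso ((Functor.whiskerRight (toOverRetract i j) (s ⋙ piQ I J)).app x) :=
        inferInstanceAs (IsIso (𝟙 x.left.1.tgt))
      exact NatIso.isIso_of_isIso_app _
    have : IsIso (Functor.whiskerRight (overPointToRetract i j) (s ⋙ piR I J)) := by
      have (x : K) : IsIso ((Functor.whiskerRight (overPointToRetract i j) (s ⋙ piR I J)).app x) :=
        inferInstanceAs (IsIso (𝟙 j))
      exact NatIso.isIso_of_isIso_app _
    have : IsIso (Functor.whiskerRight (toOverRetract i j) K.toPt) := by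
      have (x : K) : IsIso ((Functor.whiskerRight (toOverRetract i j) K.toPt).app x) :=
        inferInstanceAs (IsIso (C := Discrete PUnit) _)
      exact NatIso.isIso_of_isIso_app _
    have := D.pull₂_app_pull_pull_isIso (toOverRetract i j) s (piQ I J) A
    have := D.pull₂_app_pull_isIso (toOverRetract i j) K.toPt C
    have := D.pull₂_app_tensor_isIso (I := K) (J := K) (toOverRetract i j) G
      ((D.pull K.toPt).obj C)
    have := D.pull₂_app_pull_pull_isIso (overPointToRetract i j) s (piR I J) B
    exact D.fiber_map_bijective (toOverRetract i j) (overPointToRetract i j)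
      -- At `overPoint` both legs are identities, up to writing `𝟙 i` as `𝟙 i ≫ 𝟙 i`.
      (CostructuredArrow.ext _ _ (Prod.ext
        (TwistedArrow.Hom.ext rfl (Category.id_comp (𝟙 i)).symm) rfl)) _ _
  have hs (f : C ⟶ (D.pull y).obj P) : G ◁ (D.pull K.toPt).map f ≫
      D.squarePairing (D.evaluation A B) α (𝟙 _) (𝟙 _) =
      MonoidalClosed.uncurry (((D.pull K.toPt).map f ≫ D.squareApp α P ≫
        (D.pull s).map (D.ehomCounit A B)) ≫ ihomComparison (D.pull s) _ _) := by
    have h := uncurry_comp_map_comp_ihomComparison (D.pull s)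
      (𝟙 G) (𝟙 W) (D.ehomCounit A B) (D.squareApp α P)
    rw [ihomMap_id, Category.comp_id] at h
    rw [Category.assoc, MonoidalClosed.uncurry_natural_left, h]
    exact congrArg (_ ≫ ·) (D.squarePairing_id_id (D.evaluation A B) α)
  have e : (fun f => f ≫ D.fiberComparison i j A B) = ((ihom.adjunction _).homEquiv _ _) ∘
      ((e₁.homCongr e₂.symm).symm) ∘ (fun h : G ⊗ (D.pull K.toPt).obj C ⟶ W => (D.fiber k).map h) ∘
      (fun g : (D.pull K.toPt).obj C ⟶ (D.pull s).obj _ =>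
        MonoidalClosed.uncurry (g ≫ ihomComparison (D.pull s) ((D.pull (piQ I J)).obj A)
          ((D.pull (piR I J)).obj B))) ∘ (fun f : C ⟶ (D.pull y).obj P =>
      (D.pull K.toPt).map f ≫ D.squareApp α P ≫ (D.pull s).map (D.ehomCounit A B)) := by
    funext f
    rw [Function.comp_apply, ← Equiv.symm_apply_eq]
    refine (D.uncurry_comp_fiberComparison i j A B f).trans ?_
    refine (he f).trans ?_
    rw [hs]
    rfl
  rw [e]
  exact (Equiv.bijective _).comp ((Equiv.bijective _).comp (b₃.comp (b₂.comp b₁)))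

/-- Both composites transpose to restrictions of the same evaluation for `A`, `B` to the point (1, t
j) over s i, once through tw(I') × J' and once directly. -/
theorem fiber_map_Psi_comp_fiberComparison {I I' J J' : Dia.Obj} (s : I' ⥤ I) (t : J' ⥤ J)
    (A : D.obj I) (B : D.obj J) (i : I') (j : J') :
    ∃ (e : (D.fiber (I := I'.opp.prod J') (op i, j)).obj
          ((D.pull (opProd s t)).obj (D.ehom A B)) ≅
        (D.fiber (I := I.opp.prod J) (op (s.obj i), t.obj j)).obj (D.ehom A B))
      (a : (D.fiber i).obj ((D.pull s).obj A) ≅ (D.fiber (s.obj i)).obj A)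
      (b : (D.fiber (t.obj j)).obj B ≅ (D.fiber j).obj ((D.pull t).obj B)),
      (D.fiber (I := I'.opp.prod J') (op i, j)).map (D.Psi s t A B) ≫ D.fiberComparison i j _ _ =
        e.hom ≫ D.fiberComparison (s.obj i) (t.obj j) A B ≫ ihomMap a.hom b.hom := by
  let o := opProd s t
  let y' := Obj.at (I := I'.opp.prod J') (op i, j)
  let y := Obj.at (I := I.opp.prod J) (op (s.obj i), t.obj j)
  let x' := Obj.at (I := I'.tw.prod J') (idPoint i j)
  let x := Obj.at (I := I.tw.prod J) (idPoint (s.obj i) (t.obj j))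
  -- The functors compared here take equal values on the object of the point, but agree on its
  -- identity morphism only by `map_id`; hence isomorphisms with identity components.
  let lY : y ≅ y' ⋙ o := NatIso.ofComponents (fun _ => Iso.refl _)
    fun _ => congrArg (𝟙 (y.obj _) ≫ ·) (o.map_id ((op i, j) : (I'.opp.prod J').carrier)).symm
  let lI : Obj.at (s.obj i) ≅ Obj.at i ⋙ s := NatIso.ofComponents (fun _ => Iso.refl _)
    fun _ => congrArg (_ ≫ ·) (s.map_id _).symm
  let lJ : Obj.at j ⋙ t ≅ Obj.at (t.obj j) := NatIso.ofComponents (fun _ => Iso.refl _)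
    fun _ => congrArg (· ≫ _) (t.map_id _)
  -- tw(s) sends 1_i to s(1_i), which equals the identity of s i only propositionally, so the two
  -- points are linked by a morphism with identity components.
  let θ₀ : idPoint (s.obj i) (t.obj j) ⟶ (twProd s t).obj (idPoint i j) :=
    (⟨𝟙 (s.obj i), 𝟙 (s.obj i), by
      change 𝟙 _ ≫ 𝟙 _ ≫ 𝟙 _ = s.map (𝟙 i)
      rw [s.map_id, Category.id_comp, Category.id_comp]⟩, 𝟙 (t.obj j))
  let θ : x ⟶ x' ⋙ twProd s t :=
    { app := fun _ => θ₀
      naturality := fun _ _ _ => (Category.id_comp θ₀).trans ((Category.comp_id θ₀).symm.trans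
        (congrArg (θ₀ ≫ ·) ((twProd s t).map_id (idPoint i j)).symm)) }
  let e : (D.pull y').obj ((D.pull o).obj (D.ehom A B)) ≅ (D.pull y).obj (D.ehom A B) :=
    (D.pullComp y' o).symm.app _ ≪≫ asIso ((D.pull₂ lY.hom).app _)
  let a : (D.fiber i).obj ((D.pull s).obj A) ≅ (D.fiber (s.obj i)).obj A :=
    (D.pullComp (Obj.at i) s).symm.app _ ≪≫ asIso ((D.pull₂ lI.hom).app _)
  let b : (D.fiber (t.obj j)).obj B ≅ (D.fiber j).obj ((D.pull t).obj B) :=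
    asIso ((D.pull₂ lJ.hom).app _) ≪≫ (D.pullComp (Obj.at j) t).app _
  refine ⟨e, a, b, MonoidalClosed.uncurry_injective ?_⟩
  have h1 := D.pairing_squarePairing (D.evaluation A B) (cellP s t) (cellQ s t) (cellR s t)
    (pointCellP i j) (pointCellQ i j) (pointCellR i j)
  have h2 := D.pairing_whiskerRight (D.evaluation A B) θ
    (Functor.whiskerLeft x' (cellP s t) ≫ Functor.whiskerRight (pointCellP i j) o)
    (Functor.whiskerLeft x' (cellQ s t) ≫ Functor.whiskerRight (pointCellQ i j) s)
    (lJ.hom ≫ pointCellR (s.obj i) (t.obj j))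
  have h3 := D.pairing_comp (D.evaluation A B) (pointCellP (s.obj i) (t.obj j))
    (pointCellQ (s.obj i) (t.obj j)) (pointCellR (s.obj i) (t.obj j)) lY.hom lI.hom lJ.hom
  have e1 : Functor.whiskerRight θ (piP I J) ≫ Functor.whiskerLeft x' (cellP s t) ≫
      Functor.whiskerRight (pointCellP i j) o = pointCellP (s.obj i) (t.obj j) ≫ lY.hom := by
    refine NatTrans.ext (funext fun _ => ?_)
    exact congrArg (fun f => 𝟙 (y.obj _) ≫ 𝟙 (y.obj _) ≫ f)
      (o.map_id ((op i, j) : (I'.opp.prod J').carrier)) |>.trans (Category.id_comp _)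
  have e2 : Functor.whiskerRight θ (piQ I J) ≫ Functor.whiskerLeft x' (cellQ s t) ≫
      Functor.whiskerRight (pointCellQ i j) s = pointCellQ (s.obj i) (t.obj j) ≫ lI.hom := by
    ext _
    exact congrArg (fun f => 𝟙 (s.obj i) ≫ 𝟙 (s.obj i) ≫ f) (s.map_id i) |>.trans
      (Category.id_comp _)
  have e3 : Functor.whiskerRight (pointCellR i j) t ≫ Functor.whiskerLeft x' (cellR s t) =
      (lJ.hom ≫ pointCellR (s.obj i) (t.obj j)) ≫ Functor.whiskerRight θ (piR I J) := by
    ext _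
    exact congrArg (· ≫ 𝟙 (t.obj j)) ((t.map_id j).trans (Category.id_comp _).symm)
  have h4 : D.pairing (D.squarePairing (D.evaluation A B) (cellP s t) (cellQ s t) (cellR s t))
      (pointCellP i j) (pointCellQ i j) (pointCellR i j) =
      (a.hom ⊗ₘ e.hom) ≫ D.pairing (D.evaluation A B) (pointCellP (s.obj i) (t.obj j))
        (pointCellQ (s.obj i) (t.obj j)) (pointCellR (s.obj i) (t.obj j)) ≫ b.hom := by
    refine h1.trans ?_
    rw [e1, e2, h3] at h2
    have h5 := h2.trans (congrArg (D.pairing (D.evaluation A B) _ _) e3.symm)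
    refine (congrArg (fun f => _ ≫ f ≫ _) h5.symm).trans ?_
    simp only [a, b, e, Iso.trans_hom, ← tensorHom_comp_tensorHom, Category.assoc]
    rfl
  rw [D.uncurry_comp_fiberComparison i j, ← Category.assoc, uncurry_comp_ihomMap,
    D.uncurry_comp_fiberComparison]
  refine (D.whiskerLeft_comp_pairing _ _ _ _ _).trans ?_
  rw [whiskerLeft_Psi_comp_evaluation, h4, MonoidalCategory.tensorHom_def]
  simp only [Category.assoc]
  rfl

/-- On each fiber, every other morphism in the square of `fiber_map_Psi_comp_fiberComparison` is
invertible, so (D2) applies. -/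
theorem Psi_isIso {I I' J J' : Dia.Obj} (s : I' ⥤ I) (t : J' ⥤ J) (A : D.obj I) (B : D.obj J) :
    IsIso (D.Psi s t A B) := by
  apply Prederivator.IsDerivator.conservative (D := D.toPrederivator)
  rintro ⟨⟨i⟩, j⟩
  obtain ⟨e, a, b, h⟩ := D.fiber_map_Psi_comp_fiberComparison s t A B i j
  have := D.fiberComparison_isIso ((D.pull s).obj A) ((D.pull t).obj B) i j
  have := D.fiberComparison_isIso A B (s.obj i) (t.obj j)
  rw [← IsIso.eq_comp_inv] at h
  have h' : IsIso ((e.hom ≫ D.fiberComparison (s.obj i) (t.obj j) A B ≫ ihomMap a.hom b.hom) ≫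
    inv (D.fiberComparison i j ((D.pull s).obj A) ((D.pull t).obj B))) := inferInstance
  rw [← h] at h'
  exact h'

end ClosedMonoidalDerivator

end ExternalHom

theorem mainTheorem7 (Dia : ExternalHom.DiagramCategory.{w})
    (D : ExternalHom.ClosedMonoidalDerivator.{w, v, u} Dia) :
    (∀ {I I' J J' : Dia.Obj} (s : I' ⥤ I) (t : J' ⥤ J) (A : D.obj I) (B : D.obj J),
      IsIso (D.Psi s t A B)) ∧
    (∀ {I J : Dia.Obj} (A : D.obj I) (B : D.obj J) (i : I) (j : J),
      IsIso (D.fiberComparison i j A B)) :=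
  ⟨fun s t A B => D.Psi_isIso s t A B, fun A B i j => D.fiberComparison_isIso A B i j⟩
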